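/- **Prographs.** A PC prograph of size $n$ is a connected oriented planar graph without directed cycles, made of $n$ coproducts (one input, an ordered pair of left and right outputs) and $n$ products (an ordered pair of left and right inputs, one output); every output of an operator is connected to an input of an operator, except that one input (of a coproduct) and one output (of a product) remain unconnected and are the global input and the global output, both lying on the exterior face. It is drawn from bottom to top, and is considered up to renaming its operators. The only prograph of size $0$ is a single wire from the global input to the global output. The operators of a prograph of size $n$ receive the labels $1,2,\dots,2n$ from bottom to top and from left to right: the next label always goes to the leftmost operator all of whose inputs come from already labelled operators (or from the global input). **Trees.** For a (planar) binary tree $T$ let $dg(T)$, its number of disabled grafting sites, be the number of leaves to the left of its last node, where nodes are listed by depth-left-first search (root, left subtree, right subtree), and $dg(T)=0$ if $T$ has no node. Let $C(n,k)$ be the coefficient of $q^k$ in $Cat_n(q)=\sum_{\mathrm{size}(T)=n}q^{dg(T)}$, the sum being over the binary trees with $n$ nodes. For $n\ge 1$ they form a row of the Catalan triangle, namely $$C(n,k)=\binom{n-1+k}{k}-\binom{n-1+k}{k-1}\qquad(0\le k<n).$$ **Proposition.** For every $n\ge 0$, the PC prographs of size $n$ in which the coproducts receive the labels $1,\dots,n$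 and the products receive the labels $n+1,\dots,2n$ are counted by the pairs $(T_1,T_2)$ of binary trees of size $n$ with $dg(T_1)+dg(T_2)\le n$. Equivalently, their number is $$\sum_{d_1+d_2\le n}C(n,d_1)\,C(n,d_2)=\binom{3n}{n}-2\binom{3n}{n-1}+\binom{3n}{n-2}.$$ Here a binomial coefficient with a negative lower index is $0$. (The numbers are $1,1,4,21,121,728,4488,\dots$, OEIS A274969.) -/

import Mathlib

/-! ## Product-coproduct prographs -/

namespace PCPrograph

/-- The operators of a PC prograph of size `n`: `n` coproducts and `n` products. -/
inductive Op (n : ℕ) : Type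
  | cop (c : Fin n)
  | prod (p : Fin n)
  deriving DecidableEq

/-- The places where a wire starts: the global input, the left and right outputs of the
coproducts, the outputs of the products. -/
inductive OutPort (n : ℕ) : Type
  | source
  | copLeft (c : Fin n)
  | copRight (c : Fin n)
  | prodOut (p : Fin n)
  deriving DecidableEq

/-- The places where a wire ends: the global output, the inputs of the coproducts, the left and
right inputs of the products. -/
inductive InPort (n : ℕ) : Type
  | sink
  | copIn (c : Fin n)
  | prodLeft (p : Fin n)
  | prodRight (p : Fin n)
  deriving DecidableEq

/-- The operator that a port belongs to (none for the global input). -/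
def OutPort.owner {n : ℕ} : OutPort n → Option (Op n)
  | .source => none
  | .copLeft c => some (.cop c)
  | .copRight c => some (.cop c)
  | .prodOut p => some (.prod p)

/-- The operator that a port belongs to (none for the global output). -/
def InPort.owner {n : ℕ} : InPort n → Option (Op n)
  | .sink => none
  | .copIn c => some (.cop c)
  | .prodLeft p => some (.prod p)
  | .prodRight p => some (.prod p)

/-- The inputs of an operator, from left to right. -/
def Op.inputs {n : ℕ} : Op n → List (InPort n)
  | .cop c => [.copIn c]
  | .prod p => [.prodLeft p, .prodRight p]

/-- The outputs of an operator, from left to right. -/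
def Op.outputs {n : ℕ} : Op n → List (OutPort n)
  | .cop c => [.copLeft c, .copRight c]
  | .prod p => [.prodOut p]

/-! ### Planarity

A way to plug every output into an input is drawn on the sphere by a rotation system. The global
input and the global output are the two half-edges at one additional vertex of degree two: this
is the edge that joins the output to the input on the exterior side of the sphere. -/

/-- Half-edges of the closed-up graph. -/
abbrev HalfEdge (n : ℕ) : Type := OutPort n ⊕ InPort n

/-- The next half-edge counterclockwise around the same vertex. Wires run from bottom to top, so
around a coproduct one meets its input (below), its right output, its left output, and around a
product its output (above), its left input, its right input. -/
def next {n : ℕ} : HalfEdge n → HalfEdge n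
  | .inr (.copIn c) => .inl (.copRight c)
  | .inl (.copRight c) => .inl (.copLeft c)
  | .inl (.copLeft c) => .inr (.copIn c)
  | .inl (.prodOut p) => .inr (.prodLeft p)
  | .inr (.prodLeft p) => .inr (.prodRight p)
  | .inr (.prodRight p) => .inl (.prodOut p)
  | .inl .source => .inr .sink
  | .inr .sink => .inl .source

/-- `next` as a permutation of the half-edges; every cycle has length at most three. -/
def rotation (n : ℕ) : Equiv.Perm (HalfEdge n) where
  toFun := next
  invFun h := match h with
    | .inl .source => .inr .sink
    | .inr .sink => .inl .source
    | h => next (next h)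
  left_inv := by rintro (_ | _) <;> rename_i x <;> cases x <;> rfl
  right_inv := by rintro (_ | _) <;> rename_i x <;> cases x <;> rfl

/-- The involution that exchanges the two halves of every wire. -/
def opposite {n : ℕ} (w : OutPort n ≃ InPort n) : Equiv.Perm (HalfEdge n) :=
  (Equiv.sumCongr w w.symm).trans (Equiv.sumComm _ _)

/-- The faces of the rotation system: the cycles (fixed points included) of the permutation
`rotation ∘ opposite`. -/
def Face {n : ℕ} (w : OutPort n ≃ InPort n) : Type :=
  Quotient (Equiv.Perm.SameCycle.setoid (rotation n * opposite w))

/-- `Feeds w u v`: some wire leads from an output of `u` to an input of `v`. -/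
def Feeds {n : ℕ} (w : OutPort n ≃ InPort n) (u v : Op n) : Prop :=
  ∃ x ∈ u.outputs, w x ∈ v.inputs

/-- A PC prograph of size `n` with named operators: a connected, oriented graph without
(directed) cycles on `n` coproducts and `n` products, whose drawing is planar. Planarity is
Euler's formula `V + F = E + 2` for the closed-up graph, which has `2 n + 1` vertices (the
additional one included) and `3 n + 1` edges. Since there are no cycles, for `n ≥ 1` the global
input is plugged into a coproduct and the global output comes from a product. -/
@[ext]
structure Named (n : ℕ) : Type where
  /-- The input into which each output is plugged. -/
  wire : OutPort n ≃ InPort n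
  connected : (SimpleGraph.fromRel (Feeds wire)).Preconnected
  acyclic : ∀ v, ¬ Relation.TransGen (Feeds wire) v v
  planar : (2 * n + 1) + Nat.card (Face wire) = (3 * n + 1) + 2

/-! ### Renaming the operators -/

/-- Renaming of coproducts and products. -/
def Op.map {n : ℕ} (σ τ : Equiv.Perm (Fin n)) : Op n → Op n
  | .cop c => .cop (σ c)
  | .prod p => .prod (τ p)

/-- Renaming of coproducts and products. -/
def OutPort.map {n : ℕ} (σ τ : Equiv.Perm (Fin n)) : OutPort n → OutPort n
  | .source => .source
  | .copLeft c => .copLeft (σ c)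
  | .copRight c => .copRight (σ c)
  | .prodOut p => .prodOut (τ p)

/-- Renaming of coproducts and products. -/
def InPort.map {n : ℕ} (σ τ : Equiv.Perm (Fin n)) : InPort n → InPort n
  | .sink => .sink
  | .copIn c => .copIn (σ c)
  | .prodLeft p => .prodLeft (τ p)
  | .prodRight p => .prodRight (τ p)

/-- `G` and `H` differ only by the names of the operators. -/
def Iso {n : ℕ} (G H : Named n) : Prop :=
  ∃ σ τ : Equiv.Perm (Fin n), ∀ x, H.wire (x.map σ τ) = (G.wire x).map σ τ

theorem iso_refl {n : ℕ} (G : Named n) : Iso G G := by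
  refine ⟨1, 1, fun x => ?_⟩
  have h1 : x.map 1 1 = x := by cases x <;> rfl
  have h2 : ∀ y : InPort n, y.map 1 1 = y := fun y => by cases y <;> rfl
  rw [h1, h2]

theorem iso_symm {n : ℕ} {G H : Named n} (h : Iso G H) : Iso H G := by
  obtain ⟨σ, τ, h⟩ := h
  refine ⟨σ⁻¹, τ⁻¹, fun x => ?_⟩
  have h1 : (x.map σ⁻¹ τ⁻¹).map σ τ = x := by cases x <;> simp [OutPort.map]
  have h2 : ∀ y : InPort n, (y.map σ τ).map σ⁻¹ τ⁻¹ = y := fun y => by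
    cases y <;> simp [InPort.map]
  have h3 := h (x.map σ⁻¹ τ⁻¹)
  rw [h1] at h3
  rw [h3, h2]

theorem iso_trans {n : ℕ} {G H K : Named n} (h : Iso G H) (k : Iso H K) : Iso G K := by
  obtain ⟨σ, τ, h⟩ := h
  obtain ⟨σ', τ', k⟩ := k
  refine ⟨σ' * σ, τ' * τ, fun x => ?_⟩
  have h1 : x.map (σ' * σ) (τ' * τ) = (x.map σ τ).map σ' τ' := by cases x <;> rfl
  have h2 : ∀ y : InPort n, y.map (σ' * σ) (τ' * τ) = (y.map σ τ).map σ' τ' := fun y => by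
    cases y <;> rfl
  rw [h1, h2, k, h]

/-- Equality of prographs up to the names of the operators. -/
instance isoSetoid (n : ℕ) : Setoid (Named n) where
  r := Iso
  iseqv := ⟨iso_refl, iso_symm, iso_trans⟩

/-! ### The labelling of the operators

Operators are labelled from bottom to top and from left to right: the next label goes to the
leftmost operator all of whose entries come from operators that are already labelled (or from
the global input). The state is the list, from left to right, of the open wires, i.e. those
that leave the part that is already labelled; each wire is named by the place where it starts. -/

namespace Named

/-- All entries of `v` are open wires. -/
def Ready {n : ℕ} (G : Named n) (F : List (OutPort n)) (v : Op n) : Prop :=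
  ∀ y ∈ v.inputs, G.wire.symm y ∈ F

instance {n : ℕ} (G : Named n) (F : List (OutPort n)) : DecidablePred (G.Ready F) :=
  fun v => inferInstanceAs (Decidable (∀ y ∈ v.inputs, G.wire.symm y ∈ F))

/-- The leftmost operator that is ready. -/
def leftmostReady {n : ℕ} (G : Named n) (F : List (OutPort n)) : Option (Op n) :=
  (F.filterMap (fun x => (G.wire x).owner)).find? (fun v => decide (G.Ready F v))

/-- The open wires after `v` has been labelled: the leftmost entry of `v` is replaced by the
outputs of `v`, and its other entry, if there is one, disappears. -/
def advance {n : ℕ} (G : Named n) (F : List (OutPort n)) (v : Op n) : List (OutPort n) :=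
  F.flatMap (fun x =>
    if v.inputs.head? = some (G.wire x) then v.outputs
    else if G.wire x ∈ v.inputs then []
    else [x])

/-- The operators that get the next `k` labels, in order, when the open wires are `F`. -/
def labelFrom {n : ℕ} (G : Named n) : ℕ → List (OutPort n) → List (Op n)
  | 0, _ => []
  | k + 1, F =>
    match G.leftmostReady F with
    | none => []
    | some v => v :: G.labelFrom k (G.advance F v)

/-- The operators in the order of their labels `1, 2, …, 2 n`. -/
def labelling {n : ℕ} (G : Named n) : List (Op n) :=
  G.labelFrom (2 * n) [OutPort.source]

/-- The operator `v` receives the label `i` (labels start at `1`). -/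
def HasLabel {n : ℕ} (G : Named n) (v : Op n) (i : ℕ) : Prop :=
  1 ≤ i ∧ G.labelling[i - 1]? = some v

/-- The labels of the coproducts are `1, …, n`, those of the products are `n + 1, …, 2 n`. -/
def CoproductsFirst {n : ℕ} (G : Named n) : Prop :=
  (∀ c : Fin n, ∃ i ∈ Finset.Icc 1 n, G.HasLabel (.cop c) i) ∧
    (∀ p : Fin n, ∃ i ∈ Finset.Icc (n + 1) (2 * n), G.HasLabel (.prod p) i)

end Named

/-! The labelling does not depend on the names of the operators. -/

section Invariance

variable {n : ℕ} {G H : Named n} {σ τ : Equiv.Perm (Fin n)}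

theorem OutPort.map_injective : Function.Injective (OutPort.map (n := n) σ τ) := by
  intro x y h
  cases x <;> cases y <;> simp_all [OutPort.map]

theorem InPort.map_injective : Function.Injective (InPort.map (n := n) σ τ) := by
  intro x y h
  cases x <;> cases y <;> simp_all [InPort.map]

theorem inputs_map (v : Op n) : (v.map σ τ).inputs = v.inputs.map (InPort.map σ τ) := by
  cases v <;> rfl

theorem outputs_map (v : Op n) : (v.map σ τ).outputs = v.outputs.map (OutPort.map σ τ) := by
  cases v <;> rfl

theorem owner_map (y : InPort n) : (y.map σ τ).owner = y.owner.map (Op.map σ τ) := by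
  cases y <;> rfl

theorem ready_map (h : ∀ x, H.wire (x.map σ τ) = (G.wire x).map σ τ) (F : List (OutPort n))
    (v : Op n) : H.Ready (F.map (OutPort.map σ τ)) (v.map σ τ) ↔ G.Ready F v := by
  have h' : ∀ y, H.wire.symm (y.map σ τ) = (G.wire.symm y).map σ τ := fun y => by
    rw [Equiv.symm_apply_eq, h, Equiv.apply_symm_apply]
  simp only [Named.Ready, inputs_map, List.forall_mem_map, h',
    List.mem_map_of_injective OutPort.map_injective]

theorem leftmostReady_map (h : ∀ x, H.wire (x.map σ τ) = (G.wire x).map σ τ)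
    (F : List (OutPort n)) :
    H.leftmostReady (F.map (OutPort.map σ τ)) = (G.leftmostReady F).map (Op.map σ τ) := by
  have h1 : (F.map (OutPort.map σ τ)).filterMap (fun x => (H.wire x).owner) =
      (F.filterMap (fun x => (G.wire x).owner)).map (Op.map σ τ) := by
    rw [List.filterMap_map, List.map_filterMap]
    congr 1
    funext x
    simp [h, owner_map]
  unfold Named.leftmostReady
  rw [h1, List.find?_map]
  congr 2
  funext v
  simp [ready_map h]

theorem advance_map (h : ∀ x, H.wire (x.map σ τ) = (G.wire x).map σ τ) (F : List (OutPort n))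
    (v : Op n) : H.advance (F.map (OutPort.map σ τ)) (v.map σ τ) =
      (G.advance F v).map (OutPort.map σ τ) := by
  unfold Named.advance
  rw [List.flatMap_map, List.map_flatMap]
  congr 1
  funext x
  have h1 : (v.map σ τ).inputs.head? = some (H.wire (x.map σ τ)) ↔
      v.inputs.head? = some (G.wire x) := by
    rw [inputs_map, h, List.head?_map, ← Option.map_some]
    exact (Option.map_injective InPort.map_injective).eq_iff
  have h2 : H.wire (x.map σ τ) ∈ (v.map σ τ).inputs ↔ G.wire x ∈ v.inputs := by
    rw [inputs_map, h, List.mem_map_of_injective InPort.map_injective]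
  simp only [h1, h2]
  split_ifs <;> simp [outputs_map]

theorem labelFrom_map (h : ∀ x, H.wire (x.map σ τ) = (G.wire x).map σ τ) (k : ℕ)
    (F : List (OutPort n)) :
    H.labelFrom k (F.map (OutPort.map σ τ)) = (G.labelFrom k F).map (Op.map σ τ) := by
  induction k generalizing F with
  | zero => rfl
  | succ k ih =>
    simp only [Named.labelFrom]
    rw [leftmostReady_map h]
    cases G.leftmostReady F with
    | none => rfl
    | some v => simp [advance_map h, ih]

theorem labelling_map (h : ∀ x, H.wire (x.map σ τ) = (G.wire x).map σ τ) :
    H.labelling = G.labelling.map (Op.map σ τ) :=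
  labelFrom_map h (2 * n) [OutPort.source]

theorem coproductsFirst_of_iso (h : Iso G H) (hG : G.CoproductsFirst) : H.CoproductsFirst := by
  obtain ⟨σ, τ, h⟩ := h
  have key : ∀ v i, G.HasLabel v i → H.HasLabel (v.map σ τ) i := by
    rintro v i ⟨h1, h2⟩
    refine ⟨h1, ?_⟩
    rw [labelling_map h, List.getElem?_map, h2]
    rfl
  constructor
  · intro c
    obtain ⟨i, hi, hl⟩ := hG.1 (σ.symm c)
    refine ⟨i, hi, ?_⟩
    simpa [Op.map] using key _ i hl
  · intro p
    obtain ⟨i, hi, hl⟩ := hG.2 (τ.symm p)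
    refine ⟨i, hi, ?_⟩
    simpa [Op.map] using key _ i hl

end Invariance

end PCPrograph

/-- PC prographs of size `n`. -/
def PCPrograph (n : ℕ) : Type := Quotient (PCPrograph.isoSetoid n)

/-- The labels of the coproducts are `1, …, n`, those of the products are `n + 1, …, 2 n`. -/
def PCPrograph.CoproductsFirst {n : ℕ} (P : PCPrograph n) : Prop :=
  Quotient.lift (fun G : PCPrograph.Named n => G.CoproductsFirst)
    (fun _ _ h => propext ⟨PCPrograph.coproductsFirst_of_iso h,
      PCPrograph.coproductsFirst_of_iso (PCPrograph.iso_symm h)⟩) P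

/-! ## Disabled grafting sites of binary trees -/

/-- The number of leaves to the left of the last node, where the nodes are listed by the
depth-left-first search (root, then left subtree, then right subtree). The last node lies in the
right subtree if that has a node, otherwise in the left subtree if that has a node, and
otherwise it is the root, with no leaf to its left. -/
def disabledSites : BinaryTree Unit → ℕ
  | .nil => 0
  | .node _ l .nil => disabledSites l
  | .node _ l (.node a r₁ r₂) => l.numLeaves + disabledSites (.node a r₁ r₂)

/-- The sum of `q ^ disabledSites T` over the binary trees `T` with `n` nodes. -/
noncomputable def catPoly (n : ℕ) : Polynomial ℤ :=
  ∑ T ∈ BinaryTree.treesOfNumNodesEq n, Polynomial.X ^ disabledSites T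

/-- The coefficient `C(n, k)` of `q ^ k` in `catPoly n`. For `n ≥ 1`, these are the entries of a row
`1, n - 1, …` of the Catalan triangle. -/
noncomputable def catTriangle (n k : ℕ) : ℤ := (catPoly n).coeff k

/-- The binomial coefficient with an integer lower index; it is zero if that is negative. -/
def binom (a : ℕ) (k : ℤ) : ℤ := if 0 ≤ k then (a.choose k.toNat : ℤ) else 0

/-!
The argument reads everything off sequences.

*Trees.* Removing the last node of a tree `T` and remembering `disabledSites T` is reversible: a
node can be grafted back at any leaf that is not to the left of the last node, and it then becomes
the last node. Hence the trees with `n` nodes are the weakly increasing sequences `p` with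
`p i ≤ i`, the last term being the number of disabled sites, and the numbers `C(n, k)` satisfy the
recurrence `C(n + 1, k) = ∑ j ≤ k, C(n, j)` of the Catalan triangle.

*Prographs.* When the coproducts come first, draw the prograph operator by operator, in the order
of the labels, and record the position of each operator: the number of open wires to the left of
its first input. By the leftmost-first rule, the position of an operator plus the number of its
inputs exceeds the position of its predecessor, for otherwise it would have been drawn first. The
positions therefore form a weakly increasing ballot sequence on the coproducts and, read from the
top and from the right, a second one on the products. The only further condition is that the two
sequences fit together in the middle, where there are `n + 1` open wires: this is the inequality on
the disabled sites.

*Planarity.* A rotation system alone does not say that the inputs of a product are adjacent open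
wires. This is extracted from the number of faces. Following a face of an acyclic prograph downwards
ends at a coproduct, between its outputs, or on one of the two outer sides, so there are at most
`n + 2` faces, and Euler's formula forces these to be distinct. Hence the regions between the open
wires are distinct, and two open wires are adjacent if the region to the right of one is the region
to the left of the other. Conversely, a drawing on adjacent wires colours its faces consistently
with `n + 2` colours, which is as many as Euler's formula requires.
-/

/-! ## Trees and their last node -/

section Trees

open BinaryTree

/-- Replace the leaf with index `k` (from left to right, from `0`) by a node. -/
def graftAt : BinaryTree Unit → ℕ → BinaryTree Unit
  | .nil, _ => .node () .nil .nil
  | .node a l r, k =>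
    if k < l.numLeaves then .node a (graftAt l k) r else .node a l (graftAt r (k - l.numLeaves))

/-- Replace the last node (which carries two leaves) by a leaf. -/
def pruneLast : BinaryTree Unit → BinaryTree Unit
  | .nil => .nil
  | .node _ .nil .nil => .nil
  | .node a (.node b l₁ l₂) .nil => .node a (pruneLast (.node b l₁ l₂)) .nil
  | .node a l (.node b r₁ r₂) => .node a l (pruneLast (.node b r₁ r₂))

theorem pruneLast_node_nil {a : Unit} {l : BinaryTree Unit} (h : l ≠ .nil) :
    pruneLast (.node a l .nil) = .node a (pruneLast l) .nil := by
  cases l <;> simp_all [pruneLast]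

theorem pruneLast_node {a : Unit} {l r : BinaryTree Unit} (h : r ≠ .nil) :
    pruneLast (.node a l r) = .node a l (pruneLast r) := by
  cases r <;> simp_all [pruneLast]

theorem disabledSites_node_nil (a : Unit) (l : BinaryTree Unit) :
    disabledSites (.node a l .nil) = disabledSites l := by
  cases l <;> simp [disabledSites]

theorem disabledSites_node {a : Unit} {l r : BinaryTree Unit} (h : r ≠ .nil) :
    disabledSites (.node a l r) = l.numLeaves + disabledSites r := by
  cases r <;> simp_all [disabledSites]

theorem disabledSites_lt {T : BinaryTree Unit} (h : T ≠ .nil) : disabledSites T < T.numNodes := by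
  induction T with
  | nil => exact absurd rfl h
  | node a l r ihl ihr =>
    obtain rfl | hr := eq_or_ne r .nil
    · rw [disabledSites_node_nil]
      obtain rfl | hl := eq_or_ne l .nil
      · simp [disabledSites, numNodes]
      · have := ihl hl
        simp only [numNodes]; omega
    · rw [disabledSites_node hr, numLeaves_eq_numNodes_succ]
      have := ihr hr
      simp only [numNodes]; omega

theorem disabledSites_le (T : BinaryTree Unit) : disabledSites T ≤ T.numNodes := by
  cases T with
  | nil => simp [disabledSites]
  | node a l r => exact (disabledSites_lt (by simp)).le

theorem ne_nil_of_numNodes_eq_succ {n : ℕ} {T : BinaryTree Unit} (h : T.numNodes = n + 1) :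
    T ≠ .nil := by
  rintro rfl
  simp [numNodes] at h

theorem graftAt_ne_nil (T : BinaryTree Unit) (k : ℕ) : graftAt T k ≠ .nil := by
  cases T with
  | nil => simp [graftAt]
  | node a l r => rw [graftAt]; split_ifs <;> simp

theorem numNodes_graftAt (T : BinaryTree Unit) (k : ℕ) :
    (graftAt T k).numNodes = T.numNodes + 1 := by
  induction T generalizing k with
  | nil => simp [graftAt, numNodes]
  | node a l r ihl ihr =>
    rw [graftAt]
    split_ifs
    · simp only [numNodes, ihl]; omega
    · simp only [numNodes, ihr]; omega

theorem numNodes_pruneLast {T : BinaryTree Unit} (h : T ≠ .nil) :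
    (pruneLast T).numNodes + 1 = T.numNodes := by
  induction T with
  | nil => exact absurd rfl h
  | node a l r ihl ihr =>
    obtain rfl | hr := eq_or_ne r .nil
    · obtain rfl | hl := eq_or_ne l .nil
      · simp [pruneLast, numNodes]
      · rw [pruneLast_node_nil hl]
        have := ihl hl
        simp only [numNodes]; omega
    · rw [pruneLast_node hr]
      have := ihr hr
      simp only [numNodes]; omega

theorem disabledSites_graftAt {T : BinaryTree Unit} {k : ℕ} (h : disabledSites T ≤ k)
    (hk : k ≤ T.numNodes) : disabledSites (graftAt T k) = k := by
  induction T generalizing k with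
  | nil => obtain rfl : k = 0 := Nat.le_zero.1 hk; simp [graftAt, disabledSites]
  | node a l r ihl ihr =>
    have hl := l.numLeaves_eq_numNodes_succ
    simp only [numNodes] at hk
    rw [graftAt]
    split_ifs with hlt
    · obtain rfl | hr := eq_or_ne r .nil
      · rw [disabledSites_node_nil] at h ⊢
        exact ihl h (by omega)
      · rw [disabledSites_node hr] at h
        omega
    · rw [disabledSites_node (graftAt_ne_nil _ _), ihr _ (by omega)]
      · omega
      · obtain rfl | hr := eq_or_ne r .nil
        · simp [disabledSites]
        · rw [disabledSites_node hr] at h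
          omega

theorem disabledSites_pruneLast (T : BinaryTree Unit) :
    disabledSites (pruneLast T) ≤ disabledSites T := by
  induction T with
  | nil => simp [pruneLast]
  | node a l r ihl ihr =>
    obtain rfl | hr := eq_or_ne r .nil
    · obtain rfl | hl := eq_or_ne l .nil
      · simp [pruneLast, disabledSites]
      · rw [pruneLast_node_nil hl, disabledSites_node_nil, disabledSites_node_nil]
        exact ihl
    · rw [pruneLast_node hr, disabledSites_node hr]
      by_cases hp : pruneLast r = .nil
      · rw [hp, disabledSites_node_nil, numLeaves_eq_numNodes_succ]
        have := disabledSites_le l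
        omega
      · rw [disabledSites_node hp]
        omega

theorem pruneLast_graftAt {T : BinaryTree Unit} {k : ℕ} (h : disabledSites T ≤ k)
    (hk : k ≤ T.numNodes) : pruneLast (graftAt T k) = T := by
  induction T generalizing k with
  | nil => simp [graftAt, pruneLast]
  | node a l r ihl ihr =>
    have hl := l.numLeaves_eq_numNodes_succ
    simp only [numNodes] at hk
    rw [graftAt]
    split_ifs with hlt
    · obtain rfl | hr := eq_or_ne r .nil
      · rw [disabledSites_node_nil] at h
        rw [pruneLast_node_nil (graftAt_ne_nil _ _), ihl h (by omega)]
      · rw [disabledSites_node hr] at h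
        omega
    · rw [pruneLast_node (graftAt_ne_nil _ _), ihr _ (by omega)]
      obtain rfl | hr := eq_or_ne r .nil
      · simp [disabledSites]
      · rw [disabledSites_node hr] at h
        omega

theorem graftAt_pruneLast {T : BinaryTree Unit} (h : T ≠ .nil) :
    graftAt (pruneLast T) (disabledSites T) = T := by
  induction T with
  | nil => exact absurd rfl h
  | node a l r ihl ihr =>
    obtain rfl | hr := eq_or_ne r .nil
    · obtain rfl | hl := eq_or_ne l .nil
      · simp [pruneLast, graftAt]
      · rw [pruneLast_node_nil hl, disabledSites_node_nil, graftAt, if_pos, ihl hl]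
        rw [numLeaves_eq_numNodes_succ, numNodes_pruneLast hl]
        exact disabledSites_lt hl
    · rw [pruneLast_node hr, disabledSites_node hr, graftAt, if_neg (by omega),
        Nat.add_sub_cancel_left, ihr hr]

/-- The binary trees with `n` nodes and `k` disabled grafting sites. -/
def treesWithSites (n k : ℕ) : Finset (BinaryTree Unit) :=
  (treesOfNumNodesEq n).filter (fun T => disabledSites T = k)

theorem mem_treesWithSites {n k : ℕ} {T : BinaryTree Unit} :
    T ∈ treesWithSites n k ↔ T.numNodes = n ∧ disabledSites T = k := by
  simp [treesWithSites, mem_treesOfNumNodesEq]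

theorem catTriangle_eq_card (n k : ℕ) : catTriangle n k = (treesWithSites n k).card := by
  simp only [catTriangle, catPoly, Polynomial.finsetSum_coeff, Polynomial.coeff_X_pow,
    treesWithSites, Finset.card_filter, Nat.cast_sum, Nat.cast_ite, Nat.cast_one, Nat.cast_zero,
    eq_comm]

theorem card_filter_le_eq_sum {α : Type*} (s : Finset α) (f : α → ℕ) (k : ℕ) :
    (s.filter (fun a => f a ≤ k)).card =
      ∑ d ∈ Finset.range (k + 1), (s.filter (fun a => f a = d)).card := by
  rw [Finset.card_eq_sum_card_fiberwise (f := f) (t := Finset.range (k + 1))]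
  · refine Finset.sum_congr rfl fun d hd => ?_
    rw [Finset.filter_filter]
    congr 1
    ext a
    simp only [Finset.mem_filter, Finset.mem_range] at *
    grind
  · intro a ha
    simp only [Finset.coe_filter, Finset.coe_range, Set.mem_ofPred_eq, Set.mem_Iio] at ha ⊢
    omega

theorem card_treesWithSites_zero (k : ℕ) :
    (treesWithSites 0 k).card = if k = 0 then 1 else 0 := by
  rw [treesWithSites, treesOfNumNodesEq_zero, Finset.filter_singleton]
  simp only [disabledSites, eq_comm]
  split_ifs <;> rfl

theorem treesWithSites_succ_eq_empty {n k : ℕ} (hk : n < k) : treesWithSites (n + 1) k = ∅ := by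
  refine Finset.eq_empty_of_forall_notMem fun T hT => ?_
  obtain ⟨hnodes, hsites⟩ := mem_treesWithSites.1 hT
  have := disabledSites_lt (ne_nil_of_numNodes_eq_succ hnodes)
  omega

theorem card_treesWithSites_succ {n k : ℕ} (hk : k ≤ n) :
    (treesWithSites (n + 1) k).card = ∑ d ∈ Finset.range (k + 1), (treesWithSites n d).card := by
  simp only [treesWithSites]
  rw [← card_filter_le_eq_sum]
  refine Finset.card_nbij' pruneLast (graftAt · k) ?_ ?_ ?_ ?_ <;> intro T hT <;>
    simp only [Finset.coe_filter, mem_treesOfNumNodesEq, Set.mem_ofPred_eq] at hT ⊢ <;>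
    obtain ⟨hnodes, hsites⟩ := hT
  · have := numNodes_pruneLast (ne_nil_of_numNodes_eq_succ hnodes)
    have := disabledSites_pruneLast T
    omega
  · exact ⟨by rw [numNodes_graftAt, hnodes], disabledSites_graftAt hsites (by omega)⟩
  · rw [← hsites]
    exact graftAt_pruneLast (ne_nil_of_numNodes_eq_succ hnodes)
  · exact pruneLast_graftAt hsites (by omega)

theorem card_filter_add_le_eq_sum {α : Type*} (s : Finset α) (f : α → ℕ) (n : ℕ) :
    ((s ×ˢ s).filter (fun a => f a.1 + f a.2 ≤ n)).card =
      ∑ d ∈ Finset.range (n + 1) ×ˢ Finset.range (n + 1) with d.1 + d.2 ≤ n,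
        (s.filter (fun a => f a = d.1)).card * (s.filter (fun a => f a = d.2)).card := by
  rw [Finset.card_eq_sum_card_fiberwise (f := fun a => (f a.1, f a.2))
    (t := (Finset.range (n + 1) ×ˢ Finset.range (n + 1)).filter fun d => d.1 + d.2 ≤ n)]
  · refine Finset.sum_congr rfl fun d hd => ?_
    rw [← Finset.card_product]
    congr 1
    ext a
    simp only [Finset.mem_filter, Finset.mem_product, Finset.mem_range, Prod.ext_iff] at hd ⊢
    grind
  · intro a ha
    simp only [Finset.coe_filter, Finset.mem_product, Finset.mem_range, Set.mem_ofPred_eq] at ha ⊢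
    omega

theorem card_treePairs (n : ℕ) :
    (Nat.card {T : BinaryTree Unit × BinaryTree Unit // T.1.numNodes = n ∧ T.2.numNodes = n ∧
      disabledSites T.1 + disabledSites T.2 ≤ n} : ℤ) =
      ∑ d ∈ Finset.range (n + 1) ×ˢ Finset.range (n + 1) with d.1 + d.2 ≤ n,
        catTriangle n d.1 * catTriangle n d.2 := by
  simp only [catTriangle_eq_card, treesWithSites, ← Nat.cast_mul, ← Nat.cast_sum]
  rw [← card_filter_add_le_eq_sum, Nat.cast_inj]
  refine Nat.subtype_card _ fun T => ?_
  simp [mem_treesOfNumNodesEq, and_assoc]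

/-! ## Ballot sequences -/

/-- Ballot sequences: `p 0 ≤ p 1 ≤ ⋯` with `p i ≤ i`. They encode binary trees by the positions
at which the nodes are grafted one after the other. -/
structure IsBallot {n : ℕ} (p : Fin n → ℕ) : Prop where
  mono : Monotone p
  le : ∀ i, p i ≤ i

theorem IsBallot.init {n : ℕ} {p : Fin (n + 1) → ℕ} (hp : IsBallot p) : IsBallot (Fin.init p) :=
  ⟨fun _ _ hij => hp.mono (by simpa using hij), fun i => by simpa [Fin.init] using hp.le i.castSucc⟩

theorem IsBallot.snoc {n d : ℕ} {p : Fin n → ℕ} (hp : IsBallot p) (hd : ∀ i, p i ≤ d)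
    (hdn : d ≤ n) : IsBallot (Fin.snoc p d : Fin (n + 1) → ℕ) := by
  constructor
  · intro i j hij
    induction j using Fin.lastCases with
    | last => induction i using Fin.lastCases <;> simp [hd]
    | cast j =>
      induction i using Fin.lastCases with
      | last => exact absurd hij (by simp)
      | cast i => simpa using hp.mono (by simpa using hij)
  · intro i
    induction i using Fin.lastCases with
    | last => simpa using hdn
    | cast i => simpa using hp.le i

/-- The tree obtained by grafting nodes at the positions `p 0, p 1, …` in turn. -/
def treeOf : {n : ℕ} → (Fin n → ℕ) → BinaryTree Unit
  | 0, _ => .nil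
  | _ + 1, p => graftAt (treeOf (Fin.init p)) (p (Fin.last _))

theorem numNodes_treeOf {n : ℕ} (p : Fin n → ℕ) : (treeOf p).numNodes = n := by
  induction n with
  | zero => rfl
  | succ n ih => rw [treeOf, numNodes_graftAt, ih]

theorem IsBallot.disabledSites_treeOf_le {n : ℕ} {p : Fin n → ℕ} (hp : IsBallot p) {d : ℕ}
    (hd : ∀ i, p i ≤ d) : disabledSites (treeOf p) ≤ d := by
  induction n generalizing d with
  | zero => exact Nat.zero_le d
  | succ n ih =>
    rw [treeOf, disabledSites_graftAt (ih hp.init fun i => hp.mono (Fin.le_last _))]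
    · exact hd _
    · simpa [numNodes_treeOf] using hp.le (Fin.last n)

theorem IsBallot.disabledSites_treeOf_init_le {n : ℕ} {p : Fin (n + 1) → ℕ} (hp : IsBallot p) :
    disabledSites (treeOf (Fin.init p)) ≤ p (Fin.last n) :=
  hp.init.disabledSites_treeOf_le fun _ => hp.mono (Fin.le_last _)

theorem IsBallot.last_le_numNodes {n : ℕ} {p : Fin (n + 1) → ℕ} (hp : IsBallot p) :
    p (Fin.last n) ≤ (treeOf (Fin.init p)).numNodes := by
  simpa [numNodes_treeOf] using hp.le (Fin.last n)

theorem IsBallot.disabledSites_treeOf {n : ℕ} {p : Fin (n + 1) → ℕ} (hp : IsBallot p) :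
    disabledSites (treeOf p) = p (Fin.last n) :=
  disabledSites_graftAt hp.disabledSites_treeOf_init_le hp.last_le_numNodes

theorem IsBallot.le_disabledSites_treeOf {n : ℕ} {p : Fin n → ℕ} (hp : IsBallot p) (i : Fin n) :
    p i ≤ disabledSites (treeOf p) := by
  cases n with
  | zero => exact i.elim0
  | succ n => exact hp.disabledSites_treeOf ▸ hp.mono (Fin.le_last i)

theorem treeOf_injOn (n : ℕ) : Set.InjOn treeOf {p : Fin n → ℕ | IsBallot p} := by
  induction n with
  | zero => exact fun _ _ _ _ _ => Subsingleton.elim _ _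
  | succ n ih =>
    intro p (hp : IsBallot p) q (hq : IsBallot q) h
    have hlast : p (Fin.last n) = q (Fin.last n) := by
      rw [← hp.disabledSites_treeOf, h, hq.disabledSites_treeOf]
    have htree : treeOf (Fin.init p) = treeOf (Fin.init q) := by
      rw [← pruneLast_graftAt hp.disabledSites_treeOf_init_le hp.last_le_numNodes,
        ← pruneLast_graftAt hq.disabledSites_treeOf_init_le hq.last_le_numNodes]
      exact congrArg pruneLast h
    rw [← Fin.snoc_init_self p, ← Fin.snoc_init_self q, ih hp.init hq.init htree, hlast]

theorem exists_isBallot_treeOf_eq {n : ℕ} {T : BinaryTree Unit} (hT : T.numNodes = n) :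
    ∃ p : Fin n → ℕ, IsBallot p ∧ treeOf p = T := by
  induction n generalizing T with
  | zero =>
    refine ⟨Fin.elim0, ⟨fun i => i.elim0, fun i => i.elim0⟩, ?_⟩
    cases T with
    | nil => rfl
    | node => simp [numNodes] at hT
  | succ n ih =>
    have hne := ne_nil_of_numNodes_eq_succ hT
    obtain ⟨p, hp, hpT⟩ := ih (T := pruneLast T) (by have := numNodes_pruneLast hne; omega)
    have hbound : ∀ i, p i ≤ disabledSites T := fun i =>
      (hp.le_disabledSites_treeOf i).trans (hpT ▸ disabledSites_pruneLast T)
    refine ⟨Fin.snoc p (disabledSites T), hp.snoc hbound ?_, ?_⟩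
    · have := disabledSites_lt hne
      omega
    · rw [treeOf, Fin.init_snoc, Fin.snoc_last, hpT, graftAt_pruneLast hne]

theorem IsBallot.forall_add_le_iff {n : ℕ} {p q : Fin n → ℕ} (hp : IsBallot p)
    (hq : IsBallot q) : (∀ i, p i + q i ≤ n) ↔
      disabledSites (treeOf p) + disabledSites (treeOf q) ≤ n := by
  cases n with
  | zero => simp [treeOf, disabledSites]
  | succ n =>
    rw [hp.disabledSites_treeOf, hq.disabledSites_treeOf]
    exact ⟨fun h => h _, fun h i =>
      (add_le_add (hp.mono (Fin.le_last i)) (hq.mono (Fin.le_last i))).trans h⟩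

theorem card_ballotPairs (n : ℕ) :
    Nat.card {p : (Fin n → ℕ) × (Fin n → ℕ) //
      IsBallot p.1 ∧ IsBallot p.2 ∧ ∀ i, p.1 i + p.2 i ≤ n} =
    Nat.card {T : BinaryTree Unit × BinaryTree Unit //
      T.1.numNodes = n ∧ T.2.numNodes = n ∧ disabledSites T.1 + disabledSites T.2 ≤ n} := by
  have hbij : Set.BijOn (Prod.map treeOf treeOf)
      {p : (Fin n → ℕ) × (Fin n → ℕ) | IsBallot p.1 ∧ IsBallot p.2 ∧ ∀ i, p.1 i + p.2 i ≤ n}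
      {T | T.1.numNodes = n ∧ T.2.numNodes = n ∧ disabledSites T.1 + disabledSites T.2 ≤ n} := by
    refine ⟨fun p hp => ⟨numNodes_treeOf _, numNodes_treeOf _,
      (hp.1.forall_add_le_iff hp.2.1).1 hp.2.2⟩, fun p hp q hq h => ?_, fun T hT => ?_⟩
    · exact Prod.ext (treeOf_injOn n hp.1 hq.1 (congrArg Prod.fst h))
        (treeOf_injOn n hp.2.1 hq.2.1 (congrArg Prod.snd h))
    · obtain ⟨p, hp, hpT⟩ := exists_isBallot_treeOf_eq hT.1
      obtain ⟨q, hq, hqT⟩ := exists_isBallot_treeOf_eq hT.2.1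
      refine ⟨(p, q), ⟨hp, hq, (hp.forall_add_le_iff hq).2 ?_⟩, Prod.ext hpT hqT⟩
      rw [hpT, hqT]
      exact hT.2.2
  exact Nat.card_congr (hbij.equiv _)

end Trees

/-! ## The Catalan triangle and the closed form -/

section ClosedForm

open PowerSeries

theorem binom_natCast (a k : ℕ) : binom a k = a.choose k := by simp [binom]

theorem binom_of_neg (a : ℕ) {k : ℤ} (hk : k < 0) : binom a k = 0 := by
  simp [binom, not_le.2 hk]

theorem binom_zero_right (a : ℕ) : binom a 0 = 1 := by simp [binom]

theorem binom_succ_left (a : ℕ) (k : ℤ) : binom (a + 1) k = binom a k + binom a (k - 1) := by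
  rcases lt_trichotomy k 0 with hk | rfl | hk
  · rw [binom_of_neg _ hk, binom_of_neg _ hk, binom_of_neg _ (by omega), add_zero]
  · rw [binom_zero_right, binom_zero_right, binom_of_neg _ (by omega), add_zero]
  · obtain ⟨m, rfl⟩ : ∃ m : ℕ, k = (m + 1 : ℕ) := ⟨(k - 1).toNat, by omega⟩
    rw [show ((m + 1 : ℕ) : ℤ) - 1 = m by omega, binom_natCast, binom_natCast, binom_natCast,
      Nat.choose_succ_succ']
    push_cast
    ring

/-- The number of lattice paths from `(0, 0)` to `(n, k)` that stay weakly below the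
diagonal, as given by the reflection principle. The formula vanishes at `k = n + 1` and has no such
meaning beyond. -/
def ballotNumber (n k : ℕ) : ℤ := binom (n + k) k - binom (n + k) ((k : ℤ) - 1)

theorem ballotNumber_zero_right (n : ℕ) : ballotNumber n 0 = 1 := by
  simp [ballotNumber, binom]

theorem ballotNumber_succ_succ (n k : ℕ) :
    ballotNumber (n + 1) (k + 1) = ballotNumber (n + 1) k + ballotNumber n (k + 1) := by
  simp only [ballotNumber, Nat.cast_succ, add_sub_cancel_right]
  rw [show n + 1 + (k + 1) = n + k + 1 + 1 by ring, show n + 1 + k = n + k + 1 by ring,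
    show n + (k + 1) = n + k + 1 by ring, binom_succ_left (n + k + 1) (k + 1),
    binom_succ_left (n + k + 1) k, add_sub_cancel_right]
  ring

theorem ballotNumber_succ_self (n : ℕ) : ballotNumber n (n + 1) = 0 := by
  rw [ballotNumber, Nat.cast_succ, add_sub_cancel_right, ← Nat.cast_succ, binom_natCast,
    binom_natCast, ← Nat.choose_symm_of_eq_add (show n + (n + 1) = n + 1 + n by ring), sub_self]

theorem ballotNumber_succ_left (n k : ℕ) :
    ballotNumber (n + 1) k = ∑ d ∈ Finset.range (k + 1), ballotNumber n d := by
  induction k with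
  | zero => simp [ballotNumber_zero_right]
  | succ k ih => rw [Finset.sum_range_succ, ← ih, ballotNumber_succ_succ]

theorem catTriangle_succ {n k : ℕ} (hk : k ≤ n) :
    catTriangle (n + 1) k = ∑ d ∈ Finset.range (k + 1), catTriangle n d := by
  simp only [catTriangle_eq_card, card_treesWithSites_succ hk, Nat.cast_sum]

theorem catTriangle_succ_eq_zero {n k : ℕ} (hk : n < k) : catTriangle (n + 1) k = 0 := by
  rw [catTriangle_eq_card, treesWithSites_succ_eq_empty hk, Finset.card_empty, Nat.cast_zero]

theorem catTriangle_succ_eq_ballotNumber {n k : ℕ} (hk : k ≤ n + 1) :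
    catTriangle (n + 1) k = ballotNumber n k := by
  induction n generalizing k with
  | zero =>
    obtain rfl | rfl : k = 0 ∨ k = 1 := by omega
    · simp [catTriangle_succ, catTriangle_eq_card, card_treesWithSites_zero,
        ballotNumber_zero_right]
    · rw [catTriangle_succ_eq_zero zero_lt_one, ballotNumber_succ_self]
  | succ n ih =>
    obtain rfl | hk := hk.eq_or_lt
    · rw [catTriangle_succ_eq_zero (by omega), ballotNumber_succ_self]
    · rw [catTriangle_succ (by omega), ballotNumber_succ_left]
      refine Finset.sum_congr rfl fun d hd => ih ?_
      rw [Finset.mem_range] at hd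
      omega

theorem catTriangle_eq_binom {n k : ℕ} (hk : k < n) :
    catTriangle n k = binom (n - 1 + k) k - binom (n - 1 + k) ((k : ℤ) - 1) := by
  obtain ⟨n, rfl⟩ : ∃ m, n = m + 1 := ⟨n - 1, by omega⟩
  exact catTriangle_succ_eq_ballotNumber hk.le

theorem sum_mul_eq_coeff {R : Type*} [CommRing R] (a b : ℕ → R) (n : ℕ) :
    ∑ d ∈ Finset.range (n + 1) ×ˢ Finset.range (n + 1) with d.1 + d.2 ≤ n, a d.1 * b d.2 =
      coeff n (mk a * mk b * (invOneSubPow R 1).val) := by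
  rw [invOneSubPow_val_one_eq_invUnitSub_one, coeff_mul,
    Finset.Nat.sum_antidiagonal_eq_sum_range_succ_mk,
    ← Finset.sum_fiberwise_of_maps_to (g := fun d => d.1 + d.2) (t := Finset.range (n + 1))
      (by simp)]
  refine Finset.sum_congr rfl fun i hi => ?_
  rw [Finset.mem_range] at hi
  simp only [coeff_mul, coeff_mk, coeff_invUnitsSub, one_pow, divp_one, mul_one]
  refine Finset.sum_congr ?_ fun _ _ => rfl
  ext d
  simp only [Finset.mem_filter, Finset.mem_product, Finset.mem_range,
    Finset.HasAntidiagonal.mem_antidiagonal]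
  omega

theorem coeff_X_pow_mul_invOneSubPow (d j k : ℕ) :
    coeff k ((X : ℤ⟦X⟧) ^ j * (invOneSubPow ℤ (d + 1)).val) = binom (d + k - j) ((k : ℤ) - j) := by
  rw [coeff_X_pow_mul', invOneSubPow_val_succ_eq_mk_add_choose, coeff_mk]
  split_ifs with hjk
  · rw [← Nat.cast_sub hjk, binom_natCast, Nat.add_sub_assoc hjk, Nat.choose_symm_add]
  · rw [binom_of_neg _ (by omega)]

theorem mk_ballotNumber (n : ℕ) :
    mk (ballotNumber n) = (1 - 2 * X : ℤ⟦X⟧) * (invOneSubPow ℤ (n + 2)).val := by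
  have hsplit : (1 - 2 * X : ℤ⟦X⟧) * (invOneSubPow ℤ (n + 2)).val =
      X ^ 0 * (invOneSubPow ℤ (n + 1)).val - X ^ 1 * (invOneSubPow ℤ (n + 1 + 1)).val := by
    rw [← one_sub_pow_mul_invOneSubPow_val_add_eq_invOneSubPow_val ℤ (n + 1) 1]
    ring
  ext k
  rw [hsplit, map_sub, coeff_X_pow_mul_invOneSubPow, coeff_X_pow_mul_invOneSubPow, coeff_mk,
    ballotNumber, show n + 1 + k - 1 = n + k by omega]
  simp

theorem mk_ballotNumber_sq_mul (n : ℕ) :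
    mk (ballotNumber n) * mk (ballotNumber n) * (invOneSubPow ℤ 1).val =
      X ^ 0 * (invOneSubPow ℤ (2 * n + 2 + 1)).val
        - C (2 : ℤ) * (X ^ 1 * (invOneSubPow ℤ (2 * n + 3 + 1)).val)
        + X ^ 2 * (invOneSubPow ℤ (2 * n + 4 + 1)).val := by
  have hprod : (invOneSubPow ℤ (n + 2)).val * (invOneSubPow ℤ (n + 2)).val *
      (invOneSubPow ℤ 1).val = (invOneSubPow ℤ (2 * n + 5)).val := by
    rw [← Units.val_mul, ← Units.val_mul, ← invOneSubPow_add, ← invOneSubPow_add]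
    congr 2
    ring
  rw [mk_ballotNumber, ← one_sub_pow_mul_invOneSubPow_val_add_eq_invOneSubPow_val ℤ (2 * n + 3) 2,
    ← one_sub_pow_mul_invOneSubPow_val_add_eq_invOneSubPow_val ℤ (2 * n + 4) 1,
    show C (2 : ℤ) = (2 : ℤ⟦X⟧) from map_ofNat C 2]
  linear_combination (1 - 2 * X : ℤ⟦X⟧) ^ 2 * hprod

theorem sum_catTriangle_mul (n : ℕ) :
    ∑ d ∈ Finset.range (n + 1) ×ˢ Finset.range (n + 1) with d.1 + d.2 ≤ n,
        catTriangle n d.1 * catTriangle n d.2 =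
      binom (3 * n) n - 2 * binom (3 * n) ((n : ℤ) - 1) + binom (3 * n) ((n : ℤ) - 2) := by
  rcases n with _ | n
  · simp [catTriangle_eq_card, card_treesWithSites_zero, binom, Finset.sum_filter]
  have hballot : ∑ d ∈ Finset.range (n + 2) ×ˢ Finset.range (n + 2) with d.1 + d.2 ≤ n + 1,
        catTriangle (n + 1) d.1 * catTriangle (n + 1) d.2 =
      ∑ d ∈ Finset.range (n + 2) ×ˢ Finset.range (n + 2) with d.1 + d.2 ≤ n + 1,
        ballotNumber n d.1 * ballotNumber n d.2 := by
    refine Finset.sum_congr rfl fun d hd => ?_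
    simp only [Finset.mem_filter, Finset.mem_product, Finset.mem_range] at hd
    rw [catTriangle_succ_eq_ballotNumber (by omega), catTriangle_succ_eq_ballotNumber (by omega)]
  rw [hballot, sum_mul_eq_coeff, mk_ballotNumber_sq_mul, map_add, map_sub, coeff_C_mul,
    coeff_X_pow_mul_invOneSubPow, coeff_X_pow_mul_invOneSubPow, coeff_X_pow_mul_invOneSubPow,
    show 2 * n + 2 + (n + 1) - 0 = 3 * (n + 1) by omega,
    show 2 * n + 3 + (n + 1) - 1 = 3 * (n + 1) by omega,
    show 2 * n + 4 + (n + 1) - 2 = 3 * (n + 1) by omega]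
  simp

end ClosedForm

/-! ## Acyclic wirings -/

namespace PCPrograph

variable {n : ℕ}

instance : Finite (OutPort n) := by
  let f : OutPort n → Option (Fin n ⊕ Fin n ⊕ Fin n)
    | .source => none
    | .copLeft c => some (.inl c)
    | .copRight c => some (.inr (.inl c))
    | .prodOut p => some (.inr (.inr p))
  refine Finite.of_injective f fun x y h => ?_
  cases x <;> cases y <;> simp_all [f]

instance : Finite (InPort n) := by
  let f : InPort n → Option (Fin n ⊕ Fin n ⊕ Fin n)
    | .sink => none
    | .copIn c => some (.inl c)
    | .prodLeft p => some (.inr (.inl p))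
    | .prodRight p => some (.inr (.inr p))
  refine Finite.of_injective f fun x y h => ?_
  cases x <;> cases y <;> simp_all [f]

instance : Finite (Op n) := by
  let f : Op n → Fin n ⊕ Fin n
    | .cop c => .inl c
    | .prod p => .inr p
  refine Finite.of_injective f fun x y h => ?_
  cases x <;> cases y <;> simp_all [f]

theorem OutPort.owner_eq_some {x : OutPort n} {v : Op n} : x.owner = some v ↔ x ∈ v.outputs := by
  cases x <;> cases v <;> simp [OutPort.owner, Op.outputs, eq_comm]

theorem OutPort.owner_eq_none {x : OutPort n} : x.owner = none ↔ x = .source := by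
  cases x <;> simp [OutPort.owner]

theorem InPort.owner_eq_some {y : InPort n} {v : Op n} : y.owner = some v ↔ y ∈ v.inputs := by
  cases y <;> cases v <;> simp [InPort.owner, Op.inputs, eq_comm]

theorem Op.inputs_ne_nil (v : Op n) : v.inputs ≠ [] := by
  cases v <;> simp [Op.inputs]

variable {w : OutPort n ≃ InPort n}

/-- The plugging `w` produces no directed cycle: the field `Named.acyclic`. -/
def Acyclic (w : OutPort n ≃ InPort n) : Prop := ∀ v, ¬ Relation.TransGen (Feeds w) v v

theorem source_or_feeds {v : Op n} {y : InPort n} (hy : y ∈ v.inputs) :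
    w.symm y = .source ∨ ∃ u, w.symm y ∈ u.outputs ∧ Feeds w u v := by
  rcases howner : (w.symm y).owner with _ | u
  · exact .inl (OutPort.owner_eq_none.1 howner)
  · have hu := OutPort.owner_eq_some.1 howner
    exact .inr ⟨u, hu, w.symm y, hu, by simpa using hy⟩

theorem Acyclic.wellFounded_feeds (hw : Acyclic w) : WellFounded (Feeds w) := by
  have : IsTrans (Op n) (Relation.TransGen (Feeds w)) := ⟨fun _ _ _ => Relation.TransGen.trans⟩
  have : Std.Irrefl (Relation.TransGen (Feeds w)) := ⟨hw⟩
  exact Subrelation.wf (fun h => Relation.TransGen.single h)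
    (Finite.wellFounded_of_trans_of_irrefl (Relation.TransGen (Feeds w)))

/-- The wire that starts at `x` ends at the operator at which the wire that starts at `y` begins. -/
def Precedes (w : OutPort n ≃ InPort n) (x y : OutPort n) : Prop :=
  ∃ v : Op n, w x ∈ v.inputs ∧ y ∈ v.outputs

theorem precedes_iff {x y : OutPort n} {v : Op n} (hy : y ∈ v.outputs) :
    Precedes w x y ↔ w x ∈ v.inputs := by
  refine ⟨fun ⟨u, hx, hyu⟩ => ?_, fun hx => ⟨v, hx, hy⟩⟩
  rw [← OutPort.owner_eq_some] at hy hyu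
  rwa [Option.some_injective _ (hy.symm.trans hyu)]

theorem not_precedes_source {x : OutPort n} : ¬ Precedes w x .source := by
  rintro ⟨v, -, hv⟩
  cases v <;> simp [Op.outputs] at hv

theorem Acyclic.wellFounded_precedes (hw : Acyclic w) : WellFounded (Precedes w) := by
  have acc_source : Acc (Precedes w) .source := ⟨_, fun _ h => absurd h not_precedes_source⟩
  have acc_outputs : ∀ v : Op n, ∀ y ∈ v.outputs, Acc (Precedes w) y := by
    intro v
    induction v using hw.wellFounded_feeds.induction with
    | _ v ih =>
      refine fun y hy => ⟨_, fun x hx => ?_⟩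
      rcases source_or_feeds (w := w) ((precedes_iff hy).1 hx) with h | ⟨u, hu, huv⟩
      · rw [w.symm_apply_apply] at h
        exact h ▸ acc_source
      · rw [w.symm_apply_apply] at hu
        exact ih u huv x hu
  refine ⟨fun y => ?_⟩
  rcases howner : y.owner with _ | v
  · exact OutPort.owner_eq_none.1 howner ▸ acc_source
  · exact acc_outputs v y (OutPort.owner_eq_some.1 howner)

theorem Acyclic.preconnected (hw : Acyclic w) : (SimpleGraph.fromRel (Feeds w)).Preconnected := by
  have reachable_first : ∀ v, ∃ r, (w .source).owner = some r ∧
      (SimpleGraph.fromRel (Feeds w)).Reachable v r := by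
    intro v
    induction v using hw.wellFounded_feeds.induction with
    | _ v ih =>
      obtain ⟨y, hy⟩ := List.exists_mem_of_ne_nil _ v.inputs_ne_nil
      rcases source_or_feeds (w := w) hy with h | ⟨u, -, huv⟩
      · refine ⟨v, ?_, .rfl⟩
        rw [← h, Equiv.apply_symm_apply]
        exact InPort.owner_eq_some.2 hy
      · obtain ⟨r, hr, hur⟩ := ih u huv
        refine ⟨r, hr, .trans (SimpleGraph.Adj.reachable ?_) hur⟩
        rw [SimpleGraph.fromRel_adj]
        refine ⟨?_, .inr huv⟩
        rintro rfl
        exact hw _ (.single huv)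
  intro u v
  obtain ⟨r, hr, hur⟩ := reachable_first u
  obtain ⟨s, hs, hvs⟩ := reachable_first v
  obtain rfl : r = s := by simpa [hr] using hs
  exact hur.trans hvs.symm

/-! ## Colouring the regions between the wires -/

/-- The face of a half-edge. -/
def faceOf (w : OutPort n ≃ InPort n) (h : HalfEdge n) : Face w :=
  Quotient.mk (Equiv.Perm.SameCycle.setoid (rotation n * opposite w)) h

theorem faceOf_eq {g h : HalfEdge n} :
    faceOf w g = faceOf w h ↔ (rotation n * opposite w).SameCycle g h := Quotient.eq

theorem faceOf_next_inr (y : InPort n) :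
    faceOf w (next (.inr y)) = faceOf w (.inl (w.symm y)) := by
  rw [eq_comm, faceOf_eq]
  exact ⟨1, by simp [opposite, rotation]⟩

theorem faceOf_next_inl (x : OutPort n) :
    faceOf w (next (.inl x)) = faceOf w (.inr (w x)) := by
  rw [eq_comm, faceOf_eq]
  exact ⟨1, by simp [opposite, rotation]⟩

/-- The faces are named after the coproduct at the lowest point of the face; `inr false` and
`inr true` name the faces to the left and to the right of the prograph. -/
abbrev FaceName (n : ℕ) : Type := Fin n ⊕ Bool

/-- The face with a given name. -/
def nameFace (w : OutPort n ≃ InPort n) : FaceName n → Face w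
  | .inl c => faceOf w (.inl (.copLeft c))
  | .inr false => faceOf w (.inr .sink)
  | .inr true => faceOf w (.inl .source)

/-- `L x` and `R x` are colours of the regions to the left and to the right of the wire that starts
at `x`. An operator passes the outer colours of its inputs on to its outputs, and a coproduct opens
a new region, named after it, between its outputs. -/
structure RegionColoring (w : OutPort n ≃ InPort n) {α : Type*} (name : FaceName n → α)
    (L R : OutPort n → α) : Prop where
  left_source : L .source = name (.inr false)
  right_source : R .source = name (.inr true)
  left_copLeft (c) : L (.copLeft c) = L (w.symm (.copIn c))
  right_copLeft (c) : R (.copLeft c) = name (.inl c)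
  left_copRight (c) : L (.copRight c) = name (.inl c)
  right_copRight (c) : R (.copRight c) = R (w.symm (.copIn c))
  left_prodOut (p) : L (.prodOut p) = L (w.symm (.prodLeft p))
  right_prodOut (p) : R (.prodOut p) = R (w.symm (.prodRight p))

/-- A region colouring that is also consistent where regions are closed: between the two inputs of
a product and at the global output. -/
structure ClosedColoring (w : OutPort n ≃ InPort n) {α : Type*} (name : FaceName n → α)
    (L R : OutPort n → α) : Prop extends RegionColoring w name L R where
  between (p) : R (w.symm (.prodLeft p)) = L (w.symm (.prodRight p))
  left_sink : L (w.symm .sink) = name (.inr false)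
  right_sink : R (w.symm .sink) = name (.inr true)

theorem closedColoring_faceOf (w : OutPort n ≃ InPort n) :
    ClosedColoring w (nameFace w) (fun x => faceOf w (.inr (w x)))
      (fun x => faceOf w (.inl x)) where
  left_source := (faceOf_next_inl _).symm
  right_source := rfl
  left_copLeft c := by
    rw [← faceOf_next_inl, Equiv.apply_symm_apply]
    rfl
  right_copLeft c := rfl
  left_copRight c := by
    rw [← faceOf_next_inl]
    rfl
  right_copRight c := by
    rw [← faceOf_next_inr]
    rfl
  left_prodOut p := by
    rw [← faceOf_next_inl, Equiv.apply_symm_apply]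
    rfl
  right_prodOut p := by
    rw [← faceOf_next_inr]
    rfl
  between p := by
    rw [← faceOf_next_inr, Equiv.apply_symm_apply]
    rfl
  left_sink := by
    rw [Equiv.apply_symm_apply]
    rfl
  right_sink := by
    rw [← faceOf_next_inr]
    rfl

theorem RegionColoring.mem_range_name {α : Type*} {name : FaceName n → α} {L R : OutPort n → α}
    (C : RegionColoring w name L R) (hw : Acyclic w) (x : OutPort n) :
    L x ∈ Set.range name ∧ R x ∈ Set.range name := by
  induction x using hw.wellFounded_precedes.induction with
  | _ x ih =>
    cases x with
    | source => exact ⟨⟨_, C.left_source.symm⟩, ⟨_, C.right_source.symm⟩⟩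
    | copLeft c =>
      rw [C.left_copLeft, C.right_copLeft]
      exact ⟨(ih _ ⟨.cop c, by simp [Op.inputs, Op.outputs]⟩).1, ⟨_, rfl⟩⟩
    | copRight c =>
      rw [C.left_copRight, C.right_copRight]
      exact ⟨⟨_, rfl⟩, (ih _ ⟨.cop c, by simp [Op.inputs, Op.outputs]⟩).2⟩
    | prodOut p =>
      rw [C.left_prodOut, C.right_prodOut]
      exact ⟨(ih _ ⟨.prod p, by simp [Op.inputs, Op.outputs]⟩).1,
        (ih _ ⟨.prod p, by simp [Op.inputs, Op.outputs]⟩).2⟩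

theorem Acyclic.nameFace_surjective (hw : Acyclic w) : Function.Surjective (nameFace w) := by
  have hcolors := (closedColoring_faceOf w).toRegionColoring.mem_range_name hw
  intro f
  induction f using Quotient.inductionOn with
  | _ h =>
    rcases h with x | y
    · exact (hcolors x).2
    · exact w.apply_symm_apply y ▸ (hcolors (w.symm y)).1

instance : Finite (Face w) := inferInstanceAs (Finite (Quotient _))

theorem card_faceName (n : ℕ) : Nat.card (FaceName n) = n + 2 := by
  rw [Nat.card_eq_fintype_card]
  simp

theorem Named.nameFace_injective (G : Named n) : Function.Injective (nameFace G.wire) := by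
  refine ((Acyclic.nameFace_surjective G.acyclic).bijective_of_nat_card_le ?_).1
  have := G.planar
  rw [card_faceName]
  omega

theorem ClosedColoring.card_face {L R : OutPort n → FaceName n} (C : ClosedColoring w id L R)
    (hw : Acyclic w) : Nat.card (Face w) = n + 2 := by
  let color : HalfEdge n → FaceName n
    | .inl x => R x
    | .inr y => L (w.symm y)
  have color_apply : ∀ h, color ((rotation n * opposite w) h) = color h := by
    rintro (x | y)
    · obtain ⟨y, rfl⟩ := w.symm.surjective x
      cases y <;> simp [color, opposite, rotation, next, C.right_copRight, C.right_prodOut,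
        C.between, C.right_sink, C.right_source]
    · obtain ⟨x, rfl⟩ := w.surjective y
      cases x <;> simp [color, opposite, rotation, next, C.left_copRight, C.left_copLeft,
        C.left_prodOut, C.right_copLeft, C.left_sink, C.left_source]
  have color_eq_of_sameCycle : ∀ g h, (rotation n * opposite w).SameCycle g h →
      color g = color h := by
    intro g h hgh
    obtain ⟨i, rfl⟩ := hgh.exists_nat_pow_eq
    clear hgh
    induction i with
    | zero => rfl
    | succ i ih => rw [pow_succ', Equiv.Perm.mul_apply, color_apply, ← ih]
  let colorFace : Face w → FaceName n := Quotient.lift color color_eq_of_sameCycle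
  have leftInverse : Function.LeftInverse colorFace (nameFace w) := by
    rintro (c | _ | _)
    · exact C.right_copLeft c
    · exact C.left_sink
    · exact C.right_source
  rw [← Nat.card_eq_of_bijective _ ⟨leftInverse.injective, hw.nameFace_surjective⟩, card_faceName]

/-- The name of the region to the left of a wire. -/
noncomputable def leftColor (hw : Acyclic w) : OutPort n → FaceName n
  | .source => .inr false
  | .copLeft c => leftColor hw (w.symm (.copIn c))
  | .copRight c => .inl c
  | .prodOut p => leftColor hw (w.symm (.prodLeft p))
termination_by x => hw.wellFounded_precedes.wrap x
decreasing_by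
  · exact ⟨.cop c, by simp [Op.inputs, Op.outputs]⟩
  · exact ⟨.prod p, by simp [Op.inputs, Op.outputs]⟩

/-- The name of the region to the right of a wire. -/
noncomputable def rightColor (hw : Acyclic w) : OutPort n → FaceName n
  | .source => .inr true
  | .copLeft c => .inl c
  | .copRight c => rightColor hw (w.symm (.copIn c))
  | .prodOut p => rightColor hw (w.symm (.prodRight p))
termination_by x => hw.wellFounded_precedes.wrap x
decreasing_by
  · exact ⟨.cop c, by simp [Op.inputs, Op.outputs]⟩
  · exact ⟨.prod p, by simp [Op.inputs, Op.outputs]⟩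

theorem regionColoring_color (hw : Acyclic w) :
    RegionColoring w id (leftColor hw) (rightColor hw) where
  left_source := by rw [leftColor]; rfl
  right_source := by rw [rightColor]; rfl
  left_copLeft c := by rw [leftColor]
  right_copLeft c := by rw [rightColor]; rfl
  left_copRight c := by rw [leftColor]; rfl
  right_copRight c := by rw [rightColor]
  left_prodOut p := by rw [leftColor]
  right_prodOut p := by rw [rightColor]

end PCPrograph

/-! ## Canonical names of the operators -/

namespace PCPrograph

variable {n : ℕ}

/-- The position of an operator, counted from `0`, when the coproducts come first and both kinds
of operators are listed in the order of their names. -/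
def Op.time : Op n → ℕ
  | .cop c => c
  | .prod p => n + p

/-- All operators in the order of `Op.time`. -/
def canonicalOrder (n : ℕ) : List (Op n) :=
  (List.finRange n).map .cop ++ (List.finRange n).map .prod

theorem Op.time_lt (v : Op n) : v.time < 2 * n := by
  cases v <;> simp only [Op.time] <;> omega

theorem Op.time_injective : Function.Injective (Op.time (n := n)) := by
  intro u v h
  cases u <;> cases v <;>
    simp only [Op.time, cop.injEq, prod.injEq, reduceCtorEq, Fin.ext_iff] at h ⊢ <;>
    omega

theorem exists_time_eq {k : ℕ} (hk : k < 2 * n) : ∃ v : Op n, v.time = k := by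
  rcases lt_or_ge k n with hkn | hkn
  · exact ⟨.cop ⟨k, hkn⟩, rfl⟩
  · exact ⟨.prod ⟨k - n, by omega⟩, by simp only [Op.time]; omega⟩

theorem time_induction {P : (k : ℕ) → k ≤ 2 * n → Prop} (zero : P 0 (Nat.zero_le _))
    (succ : ∀ v : Op n, P v.time v.time_lt.le → P (v.time + 1) v.time_lt) (k : ℕ)
    (hk : k ≤ 2 * n) : P k hk := by
  induction k with
  | zero => exact zero
  | succ k ih =>
    obtain ⟨v, rfl⟩ := exists_time_eq (Nat.lt_of_succ_le hk)
    exact succ v (ih _)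

theorem length_canonicalOrder (n : ℕ) : (canonicalOrder n).length = 2 * n := by
  simp only [canonicalOrder, List.length_append, List.length_map, List.length_finRange]
  omega

theorem getElem?_canonicalOrder_time (v : Op n) : (canonicalOrder n)[v.time]? = some v := by
  cases v with
  | cop c =>
    rw [canonicalOrder, List.getElem?_append_left (by simp [Op.time])]
    simp [Op.time]
  | prod p =>
    rw [canonicalOrder, List.getElem?_append_right (by simp [Op.time])]
    simp [Op.time]

theorem getElem?_canonicalOrder_eq_some {k : ℕ} {v : Op n} :
    (canonicalOrder n)[k]? = some v ↔ v.time = k := by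
  refine ⟨fun h => ?_, fun h => h ▸ getElem?_canonicalOrder_time v⟩
  have hk : k < (canonicalOrder n).length := (List.getElem?_eq_some_iff.1 h).1
  rw [length_canonicalOrder] at hk
  obtain ⟨u, rfl⟩ := exists_time_eq hk
  rw [getElem?_canonicalOrder_time] at h
  rw [Option.some_injective _ h]

theorem nodup_canonicalOrder (n : ℕ) : (canonicalOrder n).Nodup := by
  refine List.Nodup.append ((List.nodup_finRange n).map fun _ _ => Op.cop.inj)
    ((List.nodup_finRange n).map fun _ _ => Op.prod.inj) ?_
  simp [List.Disjoint]

theorem take_canonicalOrder_succ (v : Op n) :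
    (canonicalOrder n).take (v.time + 1) = (canonicalOrder n).take v.time ++ [v] := by
  rw [List.take_add_one, getElem?_canonicalOrder_time, Option.toList_some]

theorem mem_take_canonicalOrder {k : ℕ} {v : Op n} :
    v ∈ (canonicalOrder n).take k ↔ v.time < k := by
  rw [List.mem_iff_getElem?]
  refine ⟨fun ⟨i, hi⟩ => ?_, fun h => ⟨v.time, ?_⟩⟩
  · rw [List.getElem?_take, Option.ite_none_right_eq_some, getElem?_canonicalOrder_eq_some] at hi
    omega
  · rw [List.getElem?_take_of_lt h, getElem?_canonicalOrder_time]

theorem drop_canonicalOrder_time (v : Op n) :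
    (canonicalOrder n).drop v.time = v :: (canonicalOrder n).drop (v.time + 1) := by
  obtain ⟨hlt, hget⟩ := List.getElem?_eq_some_iff.1 (getElem?_canonicalOrder_time v)
  rw [List.drop_eq_getElem_cons hlt, hget]

theorem eq_canonicalOrder {l : List (Op n)} (hlen : l.length ≤ 2 * n)
    (hl : ∀ v : Op n, l[v.time]? = some v) : l = canonicalOrder n := by
  refine List.ext_getElem? fun k => ?_
  rcases lt_or_ge k (2 * n) with hk | hk
  · obtain ⟨v, rfl⟩ := exists_time_eq hk
    rw [hl, getElem?_canonicalOrder_time]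
  · rw [List.getElem?_eq_none (hlen.trans hk),
      List.getElem?_eq_none ((length_canonicalOrder n).trans_le hk)]

/-! ## Renaming -/

section Rename

variable {w w' : OutPort n ≃ InPort n} {σ τ : Equiv.Perm (Fin n)}

/-- `Op.map` as an equivalence. -/
def Op.mapEquiv (σ τ : Equiv.Perm (Fin n)) : Op n ≃ Op n where
  toFun := Op.map σ τ
  invFun := Op.map σ⁻¹ τ⁻¹
  left_inv v := by cases v <;> simp [Op.map]
  right_inv v := by cases v <;> simp [Op.map]

/-- `OutPort.map` as an equivalence. -/
def OutPort.mapEquiv (σ τ : Equiv.Perm (Fin n)) : OutPort n ≃ OutPort n where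
  toFun := OutPort.map σ τ
  invFun := OutPort.map σ⁻¹ τ⁻¹
  left_inv x := by cases x <;> simp [OutPort.map]
  right_inv x := by cases x <;> simp [OutPort.map]

/-- `InPort.map` as an equivalence. -/
def InPort.mapEquiv (σ τ : Equiv.Perm (Fin n)) : InPort n ≃ InPort n where
  toFun := InPort.map σ τ
  invFun := InPort.map σ⁻¹ τ⁻¹
  left_inv y := by cases y <;> simp [InPort.map]
  right_inv y := by cases y <;> simp [InPort.map]

theorem feeds_map (h : ∀ x, w' (x.map σ τ) = (w x).map σ τ) (u v : Op n) :
    Feeds w' (u.map σ τ) (v.map σ τ) ↔ Feeds w u v := by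
  simp only [Feeds, inputs_map, outputs_map, List.mem_map, exists_exists_and_eq_and, h,
    InPort.map_injective.eq_iff, exists_eq_right]

theorem Acyclic.map (hw : Acyclic w) (h : ∀ x, w' (x.map σ τ) = (w x).map σ τ) :
    Acyclic w' := by
  have symm_feeds : ∀ u v, Feeds w' u v →
      Feeds w ((Op.mapEquiv σ τ).symm u) ((Op.mapEquiv σ τ).symm v) := fun u v huv => by
    rw [← feeds_map h]
    have map_symm : ∀ u, ((Op.mapEquiv σ τ).symm u).map σ τ = u :=
      (Op.mapEquiv σ τ).apply_symm_apply
    rwa [map_symm, map_symm]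
  exact fun v hv => hw _ (Relation.TransGen.lift _ symm_feeds _ _ hv)

theorem next_map (σ τ : Equiv.Perm (Fin n)) (h : HalfEdge n) :
    next (Sum.map (OutPort.map σ τ) (InPort.map σ τ) h) =
      Sum.map (OutPort.map σ τ) (InPort.map σ τ) (next h) := by
  rcases h with x | y
  · cases x <;> rfl
  · cases y <;> rfl

theorem opposite_map (h : ∀ x, w' (x.map σ τ) = (w x).map σ τ) (g : HalfEdge n) :
    opposite w' (Sum.map (OutPort.map σ τ) (InPort.map σ τ) g) =
      Sum.map (OutPort.map σ τ) (InPort.map σ τ) (opposite w g) := by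
  have h_symm : ∀ y, w'.symm (y.map σ τ) = (w.symm y).map σ τ := fun y => by
    rw [Equiv.symm_apply_eq, h, Equiv.apply_symm_apply]
  rcases g with x | y <;> simp [opposite, h, h_symm]

theorem card_face_map (h : ∀ x, w' (x.map σ τ) = (w x).map σ τ) :
    Nat.card (Face w') = Nat.card (Face w) := by
  let e : Equiv.Perm (HalfEdge n) := Equiv.sumCongr (OutPort.mapEquiv σ τ) (InPort.mapEquiv σ τ)
  have hconj : rotation n * opposite w' = e * (rotation n * opposite w) * e⁻¹ := by
    rw [eq_mul_inv_iff_mul_eq]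
    ext1 g
    exact (congrArg next (opposite_map h g)).trans (next_map σ τ _)
  refine Nat.card_congr (Quotient.congr e fun a b => ?_).symm
  change (rotation n * opposite w).SameCycle a b ↔ (rotation n * opposite w').SameCycle (e a) (e b)
  rw [hconj, Equiv.Perm.sameCycle_conj]
  simp

theorem Named.exists_rename (G : Named n) (σ τ : Equiv.Perm (Fin n)) :
    ∃ H : Named n, ∀ x, H.wire (x.map σ τ) = (G.wire x).map σ τ := by
  let w' := (OutPort.mapEquiv σ τ).symm.trans (G.wire.trans (InPort.mapEquiv σ τ))
  have h : ∀ x, w' (x.map σ τ) = (G.wire x).map σ τ := fun x =>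
    congrArg (InPort.mapEquiv σ τ) (congrArg G.wire ((OutPort.mapEquiv σ τ).symm_apply_apply x))
  have hw' : Acyclic w' := Acyclic.map G.acyclic h
  exact ⟨⟨w', hw'.preconnected, hw', by rw [card_face_map h, G.planar]⟩, h⟩

end Rename

/-! ## Prographs with canonical names -/

theorem Named.length_labelFrom_le (G : Named n) (k : ℕ) (F : List (OutPort n)) :
    (G.labelFrom k F).length ≤ k := by
  induction k generalizing F with
  | zero => simp [labelFrom]
  | succ k ih =>
    rw [labelFrom]
    split
    · simp
    · simpa using ih _

theorem exists_perm_getElem?_add {α : Type*} {l : List α} {x : Fin n → α}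
    (hx : Function.Injective x) {m : ℕ}
    (hl : ∀ i, ∃ k, m ≤ k ∧ k < m + n ∧ l[k]? = some (x i)) :
    ∃ σ : Equiv.Perm (Fin n), ∀ i, l[m + σ i]? = some (x i) := by
  choose k hmk hkn hk using hl
  let s : Fin n → Fin n := fun i => ⟨k i - m, by have := hmk i; have := hkn i; omega⟩
  have hs : ∀ i, l[m + s i]? = some (x i) := fun i => by
    rw [← hk, Nat.add_sub_cancel' (hmk i)]
  have hs_inj : Function.Injective s := fun i j hij =>
    hx (Option.some_injective _ (by rw [← hs, ← hs, hij]))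
  exact ⟨Equiv.ofBijective s (Finite.injective_iff_bijective.1 hs_inj), hs⟩

theorem Named.CoproductsFirst.exists_iso_canonical {G : Named n} (hG : G.CoproductsFirst) :
    ∃ H, Iso G H ∧ H.labelling = canonicalOrder n := by
  obtain ⟨σ, hσ⟩ := exists_perm_getElem?_add (m := 0) (l := G.labelling) (x := Op.cop)
    (fun _ _ => Op.cop.inj) fun c => by
      obtain ⟨i, hi, -, hlabel⟩ := hG.1 c
      rw [Finset.mem_Icc] at hi
      exact ⟨i - 1, by omega, by omega, hlabel⟩
  obtain ⟨τ, hτ⟩ := exists_perm_getElem?_add (m := n) (l := G.labelling) (x := Op.prod)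
    (fun _ _ => Op.prod.inj) fun p => by
      obtain ⟨i, hi, -, hlabel⟩ := hG.2 p
      rw [Finset.mem_Icc] at hi
      exact ⟨i - 1, by omega, by omega, hlabel⟩
  have htime : ∀ v : Op n, G.labelling[(v.map σ τ).time]? = some v := by
    rintro (c | p)
    · simpa [Op.map, Op.time] using hσ c
    · exact hτ p
  obtain ⟨H, hH⟩ := G.exists_rename σ τ
  refine ⟨H, ⟨σ, τ, hH⟩, eq_canonicalOrder (H.length_labelFrom_le _ _) fun v => ?_⟩
  obtain ⟨v, rfl⟩ := (Op.mapEquiv σ τ).surjective v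
  rw [labelling_map hH, List.getElem?_map]
  exact congrArg (Option.map _) (htime v)

theorem Named.coproductsFirst_of_canonical {G : Named n} (h : G.labelling = canonicalOrder n) :
    G.CoproductsFirst := by
  have hlabel : ∀ v : Op n, G.HasLabel v (v.time + 1) := fun v =>
    ⟨by omega, by rw [Nat.add_sub_cancel, h, getElem?_canonicalOrder_time]⟩
  refine ⟨fun c => ⟨_, ?_, hlabel (.cop c)⟩, fun p => ⟨_, ?_, hlabel (.prod p)⟩⟩ <;>
    simp only [Op.time, Finset.mem_Icc] <;> omega

theorem Named.eq_of_iso_of_canonical {G H : Named n} (h : Iso G H)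
    (hG : G.labelling = canonicalOrder n) (hH : H.labelling = canonicalOrder n) : G = H := by
  obtain ⟨σ, τ, h⟩ := h
  have hlabelling := labelling_map h
  rw [hG, hH] at hlabelling
  have hmap : ∀ v : Op n, v.map σ τ = v := by
    intro v
    have hv := congrArg (fun l => l[v.time]?) hlabelling
    simp only [List.getElem?_map, getElem?_canonicalOrder_time, Option.map_some] at hv
    exact (Option.some_injective _ hv).symm
  obtain rfl : σ = 1 := Equiv.ext fun c => by simpa [Op.map] using hmap (.cop c)
  obtain rfl : τ = 1 := Equiv.ext fun p => by simpa [Op.map] using hmap (.prod p)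
  refine Named.ext (Equiv.ext fun x => ?_)
  have map_one_out : x.map 1 1 = x := by cases x <;> rfl
  have map_one_in : ∀ y : InPort n, y.map 1 1 = y := fun y => by cases y <;> rfl
  rw [← map_one_in (G.wire x), ← h x, map_one_out]

theorem card_coproductsFirst (n : ℕ) : Nat.card {P : PCPrograph n // P.CoproductsFirst} =
    Nat.card {G : Named n // G.labelling = canonicalOrder n} := by
  symm
  refine Nat.card_eq_of_bijective
    (fun G => ⟨(Quotient.mk _ G.1 : PCPrograph n), Named.coproductsFirst_of_canonical G.2⟩) ⟨?_, ?_⟩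
  · rintro ⟨G, hG⟩ ⟨H, hH⟩ h
    exact Subtype.ext (Named.eq_of_iso_of_canonical (Quotient.exact (congrArg Subtype.val h)) hG hH)
  · rintro ⟨P, hP⟩
    induction P using Quotient.inductionOn with
    | _ G =>
      obtain ⟨H, hGH, hH⟩ := Named.CoproductsFirst.exists_iso_canonical hP
      exact ⟨⟨H, hH⟩, Subtype.ext (Quotient.sound hGH).symm⟩

end PCPrograph

/-! ## Codes -/

namespace PCPrograph

variable {n : ℕ} {f : Op n → ℕ} {g : InPort n → OutPort n} {w : OutPort n ≃ InPort n}

/-- The open wires after an operator `v` has been plugged into the open wires `F`, from position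
`f v` on. -/
def plug (f : Op n → ℕ) (F : List (OutPort n)) (v : Op n) : List (OutPort n) :=
  F.take (f v) ++ v.outputs ++ F.drop (f v + v.inputs.length)

/-- The open wires after the first `k` operators of `canonicalOrder` have been plugged in at the
positions given by `f`. -/
def openWires (f : Op n → ℕ) (k : ℕ) : List (OutPort n) :=
  ((canonicalOrder n).take k).foldl (plug f) [.source]

theorem openWires_succ (v : Op n) :
    openWires f (v.time + 1) = plug f (openWires f v.time) v := by
  rw [openWires, take_canonicalOrder_succ, List.foldl_append]
  rfl

theorem plug_append {v : Op n} {A X B : List (OutPort n)} (hA : A.length = f v)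
    (hX : X.length = v.inputs.length) : plug f (A ++ X ++ B) v = A ++ v.outputs ++ B := by
  rw [plug, ← hA, ← hX, ← List.length_append, List.drop_left, List.append_assoc A X B,
    List.take_left]

/-- `f` encodes the wiring in which the wire that ends at `y` starts at `g y`: the inputs of each
operator `v` are consecutive open wires, from position `f v` on. -/
def Encodes (f : Op n → ℕ) (g : InPort n → OutPort n) : Prop :=
  ∀ v : Op n, ∃ A B, openWires f v.time = A ++ v.inputs.map g ++ B ∧ A.length = f v

theorem Encodes.exists_openWires (h : Encodes f g) (v : Op n) :
    ∃ A B, A.length = f v ∧ openWires f v.time = A ++ v.inputs.map g ++ B ∧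
      openWires f (v.time + 1) = A ++ v.outputs ++ B := by
  obtain ⟨A, B, hAB, hA⟩ := h v
  exact ⟨A, B, hA, hAB, by rw [openWires_succ, hAB, plug_append hA (List.length_map _)]⟩

theorem Encodes.mem_openWires (h : Encodes f g) {v : Op n} {y : InPort n} (hy : y ∈ v.inputs) :
    g y ∈ openWires f v.time := by
  obtain ⟨A, B, hAB, -⟩ := h v
  rw [hAB]
  exact List.mem_append_left _ (List.mem_append_right _ (List.mem_map_of_mem hy))

/-! ### Open wires and used wires -/

/-- The starting points of the wires that exist after `k` steps. -/
def startsBefore (n k : ℕ) : List (OutPort n) :=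
  .source :: ((canonicalOrder n).take k).flatMap Op.outputs

/-- The end points of the wires that are no longer open after `k` steps. -/
def endsBefore (n k : ℕ) : List (InPort n) :=
  ((canonicalOrder n).take k).flatMap Op.inputs

theorem mem_startsBefore {k : ℕ} {v : Op n} {x : OutPort n} (hx : x ∈ v.outputs) :
    x ∈ startsBefore n k ↔ v.time < k := by
  rw [← OutPort.owner_eq_some] at hx
  have hsource : x ≠ .source := by
    rintro rfl
    cases hx
  simp only [startsBefore, List.mem_cons, hsource, List.mem_flatMap, mem_take_canonicalOrder,
    false_or, ← OutPort.owner_eq_some, hx, Option.some_inj, exists_eq_right']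

theorem mem_endsBefore {k : ℕ} {v : Op n} {y : InPort n} (hy : y ∈ v.inputs) :
    y ∈ endsBefore n k ↔ v.time < k := by
  rw [← InPort.owner_eq_some] at hy
  simp only [endsBefore, List.mem_flatMap, mem_take_canonicalOrder, ← InPort.owner_eq_some, hy,
    Option.some_inj, exists_eq_right']

theorem nodup_startsBefore (n k : ℕ) : (startsBefore n k).Nodup := by
  refine List.nodup_cons.2 ⟨?_, List.nodup_flatMap.2 ⟨?_, ?_⟩⟩
  · simp [← OutPort.owner_eq_some, OutPort.owner]
  · rintro (c | p) _ <;> simp [Op.outputs]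
  · refine ((nodup_canonicalOrder n).sublist (List.take_sublist _ _)).imp ?_
    intro u v huv x hxu hxv
    rw [← OutPort.owner_eq_some] at hxu hxv
    exact huv (Option.some_injective _ (hxu.symm.trans hxv))

theorem Encodes.perm_startsBefore (h : Encodes f g) {k : ℕ} (hk : k ≤ 2 * n) :
    (openWires f k ++ (endsBefore n k).map g).Perm (startsBefore n k) := by
  induction k, hk using time_induction with
  | zero => simp [openWires, endsBefore, startsBefore]
  | succ v ih =>
    obtain ⟨A, B, -, hbefore, hafter⟩ := h.exists_openWires v
    have hends : endsBefore n (v.time + 1) = endsBefore n v.time ++ v.inputs := by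
      simp [endsBefore, take_canonicalOrder_succ]
    have hstarts : startsBefore n (v.time + 1) = startsBefore n v.time ++ v.outputs := by
      simp [startsBefore, take_canonicalOrder_succ]
    rw [hbefore] at ih
    rw [hafter, hends, hstarts]
    refine List.Perm.trans ?_ (ih.append_right _)
    simp only [List.perm_iff_count, List.count_append, List.map_append]
    omega

theorem Encodes.nodup_append (h : Encodes f g) {k : ℕ} (hk : k ≤ 2 * n) :
    (openWires f k ++ (endsBefore n k).map g).Nodup :=
  (h.perm_startsBefore hk).nodup_iff.2 (nodup_startsBefore n k)

theorem Encodes.nodup_openWires (h : Encodes f g) {k : ℕ} (hk : k ≤ 2 * n) :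
    (openWires f k).Nodup :=
  (h.nodup_append hk).of_append_left

theorem Encodes.time_lt (h : Encodes f g) {k : ℕ} (hk : k ≤ 2 * n) {v : Op n} {x : OutPort n}
    (hxv : x ∈ v.outputs) (hx : x ∈ openWires f k) : v.time < k :=
  (mem_startsBefore hxv).1 ((h.perm_startsBefore hk).subset (List.mem_append_left _ hx))

theorem Encodes.le_time (h : Encodes f g) {k : ℕ} (hk : k ≤ 2 * n) {v : Op n} {y : InPort n}
    (hyv : y ∈ v.inputs) (hy : g y ∈ openWires f k) : k ≤ v.time := by
  by_contra! hlt
  exact (List.disjoint_of_nodup_append (h.nodup_append hk)) hy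
    (List.mem_map_of_mem ((mem_endsBefore hyv).2 hlt))

theorem Encodes.acyclic (h : Encodes f w.symm) : Acyclic w := by
  have time_lt_of_feeds : ∀ u v, Feeds w u v → u.time < v.time := by
    rintro u v ⟨x, hxu, hxv⟩
    exact h.time_lt v.time_lt.le hxu (by simpa using h.mem_openWires hxv)
  have time_lt_of_transGen : ∀ u v, Relation.TransGen (Feeds w) u v → u.time < v.time := by
    intro u v huv
    induction huv with
    | single huv => exact time_lt_of_feeds _ _ huv
    | tail _ huv ih => exact ih.trans (time_lt_of_feeds _ _ huv)
  exact fun v hv => lt_irrefl _ (time_lt_of_transGen v v hv)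

/-! ### The number of open wires -/

/-- The number of open wires after `k` steps. -/
def width (n k : ℕ) : ℕ := min (k + 1) (2 * n + 1 - k)

theorem width_succ (v : Op n) :
    width n (v.time + 1) + v.inputs.length = width n v.time + v.outputs.length := by
  cases v <;> simp only [width, Op.time, Op.inputs, Op.outputs, List.length_cons, List.length_nil]
    <;> omega

theorem length_openWires_succ {v : Op n} (hlen : (openWires f v.time).length = width n v.time)
    (hv : f v + v.inputs.length ≤ width n v.time) :
    (openWires f (v.time + 1)).length = width n (v.time + 1) := by
  have := width_succ v
  simp only [openWires_succ, plug, List.length_append, List.length_take, List.length_drop]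
  omega

theorem Encodes.length_openWires (h : Encodes f g) {k : ℕ} (hk : k ≤ 2 * n) :
    (openWires f k).length = width n k := by
  induction k, hk using time_induction with
  | zero => simp [openWires, width]
  | succ v ih =>
    obtain ⟨A, B, hAB, hA⟩ := h v
    refine length_openWires_succ ih ?_
    simp only [← ih, hAB, ← hA, List.length_append, List.length_map]
    omega

theorem Encodes.fits (h : Encodes f g) (v : Op n) : f v + v.inputs.length ≤ width n v.time := by
  obtain ⟨A, B, hAB, hA⟩ := h v
  simp only [← h.length_openWires v.time_lt.le, hAB, ← hA, List.length_append, List.length_map]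
  omega

theorem Encodes.openWires_end (h : Encodes f w.symm) : openWires f (2 * n) = [w.symm .sink] := by
  have hlen := h.length_openWires le_rfl
  rw [width, show 2 * n + 1 - 2 * n = 1 by omega, min_eq_right (by omega),
    List.length_eq_one_iff] at hlen
  obtain ⟨x, hx⟩ := hlen
  obtain ⟨y, rfl⟩ := w.symm.surjective x
  rcases howner : y.owner with _ | v
  · cases y <;> simp_all [InPort.owner]
  · have := h.le_time le_rfl (InPort.owner_eq_some.1 howner) (by simp [hx])
    exact absurd v.time_lt this.not_gt

/-! ### Wirings and codes determine each other -/

theorem Encodes.wiring_eq {w' : OutPort n ≃ InPort n} (h : Encodes f w.symm)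
    (h' : Encodes f w'.symm) : w = w' := by
  refine Equiv.symm_bijective.injective (Equiv.ext fun y => ?_)
  rcases howner : y.owner with _ | v
  · obtain rfl : y = .sink := by cases y <;> simp_all [InPort.owner]
    simpa using h.openWires_end.symm.trans h'.openWires_end
  · obtain ⟨A, B, hAB, hA⟩ := h v
    obtain ⟨A', B', hAB', hA'⟩ := h' v
    rw [hAB, List.append_assoc, List.append_assoc] at hAB'
    have hblock := (List.append_inj hAB' (hA.trans hA'.symm)).2
    exact List.map_inj_left.1 (List.append_inj hblock (by simp)).1 y
      (InPort.owner_eq_some.1 howner)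

theorem length_eq_of_nodup_append {α : Type*} {A A' X B B' : List α} (hX : X ≠ [])
    (hnodup : (A ++ X ++ B).Nodup) (heq : A ++ X ++ B = A' ++ X ++ B') :
    A.length = A'.length := by
  obtain ⟨x, X, rfl⟩ := List.exists_cons_of_ne_nil hX
  classical
  have idxOf_eq : ∀ A B : List α, (A ++ (x :: X) ++ B).Nodup →
      (A ++ (x :: X) ++ B).idxOf x = A.length := by
    intro A B h
    have hx : x ∉ A := fun hxA =>
      List.disjoint_of_nodup_append h.of_append_left hxA List.mem_cons_self
    simp [List.idxOf_append_of_notMem hx]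
  rw [← idxOf_eq A B hnodup, heq, idxOf_eq A' B' (heq ▸ hnodup)]

theorem Encodes.code_eq {f' : Op n → ℕ} (h : Encodes f g) (h' : Encodes f' g) : f = f' := by
  have code_eq_of_openWires_eq : ∀ v : Op n, openWires f v.time = openWires f' v.time →
      f v = f' v := by
    intro v hv
    obtain ⟨A, B, hAB, hA⟩ := h v
    obtain ⟨A', B', hAB', hA'⟩ := h' v
    rw [← hA, ← hA']
    refine length_eq_of_nodup_append (by simpa using v.inputs_ne_nil) ?_
      (hAB.symm.trans (hv.trans hAB'))
    exact hAB ▸ h.nodup_openWires v.time_lt.le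
  have openWires_eq : ∀ k ≤ 2 * n, openWires f k = openWires f' k := by
    intro k hk
    induction k, hk using time_induction with
    | zero => rfl
    | succ v ih => rw [openWires_succ, openWires_succ, ih, plug, plug, code_eq_of_openWires_eq v ih]
  exact funext fun v => code_eq_of_openWires_eq v (openWires_eq _ v.time_lt.le)

end PCPrograph

/-! ### The wiring with a given code -/

namespace PCPrograph

variable {n : ℕ} {f : Op n → ℕ} {g : InPort n → OutPort n} {w : OutPort n ≃ InPort n}

/-- The codes of the prographs whose coproducts come first. -/
structure IsCode (f : Op n → ℕ) : Prop where
  fits (v) : f v + v.inputs.length ≤ width n v.time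
  /-- Otherwise `v` could have been plugged in to the left of `u`, and before it. -/
  lt_of_next (u v) : v.time = u.time + 1 → f u < f v + v.inputs.length

theorem IsCode.length_openWires (hf : IsCode f) {k : ℕ} (hk : k ≤ 2 * n) :
    (openWires f k).length = width n k := by
  induction k, hk using time_induction with
  | zero => simp [openWires, width]
  | succ v ih => exact length_openWires_succ ih (hf.fits v)

/-- The wiring encoded by `f`; when `f` is a code, the default value is not used. -/
def wiringOf (f : Op n → ℕ) (y : InPort n) : OutPort n :=
  match y.owner with
  | none => (openWires f (2 * n)).headD .source
  | some v => (openWires f v.time).getD (f v + v.inputs.idxOf y) .source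

theorem Op.nodup_inputs (v : Op n) : v.inputs.Nodup := by
  cases v <;> simp [Op.inputs]

theorem IsCode.encodes_wiringOf (hf : IsCode f) : Encodes f (wiringOf f) := by
  intro v
  have hfits := hf.fits v
  rw [← hf.length_openWires v.time_lt.le] at hfits
  have hinputs : v.inputs.map (wiringOf f) =
      ((openWires f v.time).drop (f v)).take v.inputs.length := by
    refine List.ext_getElem (by simp; omega) fun i hi _ => ?_
    rw [List.length_map] at hi
    rw [List.getElem_map, List.getElem_take, List.getElem_drop, wiringOf,
      InPort.owner_eq_some.2 (List.getElem_mem hi)]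
    simp only [v.nodup_inputs.idxOf_getElem i hi]
    exact List.getD_eq_getElem _ _ (by omega)
  refine ⟨(openWires f v.time).take (f v), (openWires f v.time).drop (f v + v.inputs.length), ?_,
    List.length_take_of_le (by omega)⟩
  rw [hinputs, List.append_assoc, ← List.drop_drop, List.take_append_drop, List.take_append_drop]

theorem IsCode.openWires_end (hf : IsCode f) : openWires f (2 * n) = [wiringOf f .sink] := by
  have hlen := hf.length_openWires le_rfl
  rw [width, show 2 * n + 1 - 2 * n = 1 by omega, min_eq_right (by omega),
    List.length_eq_one_iff] at hlen
  obtain ⟨x, hx⟩ := hlen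
  simp [wiringOf, InPort.owner, hx]

theorem Encodes.bijective (h : Encodes f g) (hsink : openWires f (2 * n) = [g .sink]) :
    Function.Bijective g := by
  have hperm : ((.sink :: endsBefore n (2 * n)).map g).Perm (startsBefore n (2 * n)) := by
    simpa [hsink] using h.perm_startsBefore le_rfl
  constructor
  · have mem_ends : ∀ y : InPort n, y ∈ InPort.sink :: endsBefore n (2 * n) := by
      intro y
      rcases howner : y.owner with _ | v
      · cases y <;> simp_all [InPort.owner]
      · exact List.mem_cons_of_mem _ ((mem_endsBefore (InPort.owner_eq_some.1 howner)).2 v.time_lt)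
    exact fun y y' => List.inj_on_of_nodup_map (hperm.nodup_iff.2 (nodup_startsBefore n _))
      (mem_ends y) (mem_ends y')
  · intro x
    have mem_starts : x ∈ startsBefore n (2 * n) := by
      rcases howner : x.owner with _ | v
      · rw [OutPort.owner_eq_none.1 howner]
        exact List.mem_cons_self
      · exact (mem_startsBefore (OutPort.owner_eq_some.1 howner)).2 v.time_lt
    obtain ⟨y, -, hy⟩ := List.mem_map.1 (hperm.symm.subset mem_starts)
    exact ⟨y, hy⟩

theorem IsCode.exists_encodes (hf : IsCode f) : ∃ w : OutPort n ≃ InPort n, Encodes f w.symm :=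
  ⟨(Equiv.ofBijective _ (hf.encodes_wiringOf.bijective hf.openWires_end)).symm,
    hf.encodes_wiringOf⟩

/-! ### Regions along the open wires -/

section Linked

variable {α : Type*} {name : FaceName n → α} {L R : OutPort n → α}

/-- The regions between consecutive wires of the list agree; `a` is to the left of the first wire
and `b` is to the right of the last one. -/
def Linked (L R : OutPort n → α) : α → List (OutPort n) → α → Prop
  | a, [], b => a = b
  | a, x :: F, b => L x = a ∧ Linked L R (R x) F b

theorem linked_append {a b : α} {A B : List (OutPort n)} :
    Linked L R a (A ++ B) b ↔ ∃ c, Linked L R a A c ∧ Linked L R c B b := by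
  induction A generalizing a with
  | nil => simp [Linked]
  | cons x A ih => simp [Linked, ih, and_assoc]

theorem RegionColoring.linked_outputs (C : RegionColoring w name L R) {v : Op n} {a b : α}
    (h : Linked L R a (v.inputs.map w.symm) b) : Linked L R a v.outputs b := by
  cases v with
  | cop c =>
    simp only [Op.inputs, Op.outputs, List.map_cons, List.map_nil, Linked] at h ⊢
    rw [C.left_copLeft, C.right_copLeft, C.left_copRight, C.right_copRight]
    exact ⟨h.1, rfl, h.2⟩
  | prod p =>
    simp only [Op.inputs, Op.outputs, List.map_cons, List.map_nil, Linked] at h ⊢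
    rw [C.left_prodOut, C.right_prodOut]
    exact ⟨h.1, h.2.2⟩

theorem RegionColoring.linked_append_outputs (C : RegionColoring w name L R) {v : Op n} {a b : α}
    {A B : List (OutPort n)} (h : Linked L R a (A ++ v.inputs.map w.symm ++ B) b) :
    Linked L R a (A ++ v.outputs ++ B) b := by
  simp only [linked_append] at h ⊢
  obtain ⟨d, ⟨c, hA, hinputs⟩, hB⟩ := h
  exact ⟨d, ⟨c, hA, C.linked_outputs hinputs⟩, hB⟩

theorem RegionColoring.linked_openWires (C : RegionColoring w name L R) (h : Encodes f w.symm)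
    {k : ℕ} (hk : k ≤ 2 * n) :
    Linked L R (name (.inr false)) (openWires f k) (name (.inr true)) := by
  induction k, hk using time_induction with
  | zero => exact ⟨C.left_source, C.right_source⟩
  | succ v ih =>
    obtain ⟨A, B, -, hbefore, hafter⟩ := h.exists_openWires v
    rw [hbefore] at ih
    exact hafter ▸ C.linked_append_outputs ih

theorem RegionColoring.closed (C : RegionColoring w name L R) (h : Encodes f w.symm) :
    ClosedColoring w name L R := by
  have hend := C.linked_openWires h le_rfl
  rw [h.openWires_end] at hend
  refine ⟨C, fun p => ?_, hend.1, hend.2⟩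
  have hprod := C.linked_openWires h (Op.prod p).time_lt.le
  obtain ⟨A, B, hAB, -⟩ := h (.prod p)
  simp only [hAB, linked_append] at hprod
  obtain ⟨_, ⟨_, -, hinputs⟩, -⟩ := hprod
  exact hinputs.2.1.symm

end Linked

/-- The prograph with a given code. -/
def Encodes.toNamed (h : Encodes f w.symm) : Named n where
  wire := w
  connected := h.acyclic.preconnected
  acyclic := h.acyclic
  planar := by
    have := ((regionColoring_color h.acyclic).closed h).card_face h.acyclic
    omega

end PCPrograph

/-! ## The labelling of an encoded prograph -/

namespace PCPrograph

variable {n : ℕ} {f : Op n → ℕ} {g : InPort n → OutPort n}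

theorem notMem_of_nodup_append {α : Type*} {A X B : List α} (h : (A ++ X ++ B).Nodup) {x : α}
    (hx : x ∈ X) : x ∉ A ∧ x ∉ B :=
  ⟨fun hA => List.disjoint_of_nodup_append h.of_append_left hA hx,
    fun hB => List.disjoint_of_nodup_append h (List.mem_append_right A hx) hB⟩

namespace Named

variable {G : Named n} {F A B : List (OutPort n)} {v : Op n}

/-- The open wires after the first `k` operators of `canonicalOrder` have been labelled. -/
def frontier (G : Named n) (k : ℕ) : List (OutPort n) :=
  ((canonicalOrder n).take k).foldl G.advance [.source]

theorem frontier_succ (v : Op n) : G.frontier (v.time + 1) = G.advance (G.frontier v.time) v := by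
  rw [frontier, take_canonicalOrder_succ, List.foldl_append]
  rfl

theorem labelFrom_frontier_eq_drop_iff {m k : ℕ} (hmk : k + m = 2 * n) :
    G.labelFrom m (G.frontier k) = (canonicalOrder n).drop k ↔
      ∀ v : Op n, k ≤ v.time → G.leftmostReady (G.frontier v.time) = some v := by
  induction m generalizing k with
  | zero =>
    rw [List.drop_eq_nil_of_le (by rw [length_canonicalOrder]; omega)]
    exact iff_of_true rfl fun v hv => absurd v.time_lt (by omega)
  | succ m ih =>
    obtain ⟨v, rfl⟩ := exists_time_eq (n := n) (k := k) (by omega)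
    rw [drop_canonicalOrder_time, labelFrom]
    constructor
    · intro h u hu
      rcases hready : G.leftmostReady (G.frontier v.time) with _ | v'
      · simp [hready] at h
      · simp only [hready, List.cons.injEq] at h
        obtain ⟨rfl, h⟩ := h
        rw [← frontier_succ, ih (by omega)] at h
        rcases hu.eq_or_lt with heq | hlt
        · rwa [← Op.time_injective heq]
        · exact h u hlt
    · intro h
      simp only [h v le_rfl, ← frontier_succ]
      rw [(ih (by omega)).2 fun u hu => h u (by omega)]

theorem labelling_eq_canonicalOrder_iff : G.labelling = canonicalOrder n ↔
    ∀ v : Op n, G.leftmostReady (G.frontier v.time) = some v := by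
  simpa [frontier, labelling] using labelFrom_frontier_eq_drop_iff (G := G) (zero_add (2 * n))

theorem advance_of_forall_notMem {l : List (OutPort n)} (hl : ∀ x ∈ l, G.wire x ∉ v.inputs) :
    G.advance l v = l := by
  have hkeep : ∀ x ∈ l, (if v.inputs.head? = some (G.wire x) then v.outputs
      else if G.wire x ∈ v.inputs then [] else [x]) = [x] := fun x hx => by
    rw [if_neg fun h => hl x hx (List.mem_of_head? h), if_neg (hl x hx)]
  rw [advance, List.flatMap_congr hkeep, List.flatMap_singleton']

theorem advance_inputs : G.advance (v.inputs.map G.wire.symm) v = v.outputs := by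
  cases v <;> simp [advance, Op.inputs, Op.outputs]

theorem advance_eq (hF : F.Nodup) (h : F = A ++ v.inputs.map G.wire.symm ++ B) :
    G.advance F v = A ++ v.outputs ++ B := by
  subst h
  have notMem : ∀ x, G.wire x ∈ v.inputs → x ∉ A ∧ x ∉ B := fun x hx =>
    notMem_of_nodup_append hF (List.mem_map.2 ⟨_, hx, G.wire.symm_apply_apply x⟩)
  have advance_append : ∀ l l', G.advance (l ++ l') v = G.advance l v ++ G.advance l' v :=
    fun _ _ => List.flatMap_append
  rw [advance_append, advance_append, advance_inputs,
    advance_of_forall_notMem fun x hxA hx => (notMem x hx).1 hxA,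
    advance_of_forall_notMem fun x hxB hx => (notMem x hx).2 hxB]

theorem mem_filterMap_owner {u : Op n} : (u ∈ A.filterMap fun x => (G.wire x).owner) ↔
    ∃ y ∈ u.inputs, G.wire.symm y ∈ A := by
  simp only [List.mem_filterMap, InPort.owner_eq_some]
  exact ⟨fun ⟨x, hx, hxu⟩ => ⟨_, hxu, by simpa⟩, fun ⟨y, hyu, hy⟩ => ⟨_, hy, by simpa⟩⟩

theorem leftmostReady_eq_some_iff (hF : F.Nodup) (h : F = A ++ v.inputs.map G.wire.symm ++ B) :
    G.leftmostReady F = some v ↔ ∀ u, G.Ready F u → ∀ y ∈ u.inputs, G.wire.symm y ∉ A := by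
  have hready : G.Ready F v := fun y hy => by
    rw [h]
    exact List.mem_append_left _ (List.mem_append_right _ (List.mem_map_of_mem hy))
  have hv : v ∉ A.filterMap fun x => (G.wire x).owner := fun hv => by
    obtain ⟨y, hy, hyA⟩ := mem_filterMap_owner.1 hv
    exact (notMem_of_nodup_append (h ▸ hF) (List.mem_map_of_mem hy)).1 hyA
  obtain ⟨l, hl⟩ : ∃ l, F.filterMap (fun x => (G.wire x).owner) =
      A.filterMap (fun x => (G.wire x).owner) ++ v :: l := by
    rw [h, List.append_assoc, List.filterMap_append]
    cases v <;> simp [Op.inputs, InPort.owner]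
  have hfind : G.leftmostReady F = some v ↔
      (A.filterMap fun x => (G.wire x).owner).find? (fun u => decide (G.Ready F u)) = none := by
    rw [leftmostReady, hl, List.find?_append, 
      List.find?_cons_of_pos (p := fun u => decide (G.Ready F u)) (decide_eq_true hready)]
    refine ⟨fun hfirst => ?_, fun hnone => by rw [hnone, Option.none_or]⟩
    rw [Option.or_eq_some_iff] at hfirst
    exact hfirst.elim (fun hu => absurd (List.mem_of_find?_eq_some hu) hv) And.left
  simp only [hfind, List.find?_eq_none, mem_filterMap_owner, decide_eq_true_eq]
  exact ⟨fun hA u hu y hy hyA => hA u ⟨y, hy, hyA⟩ hu,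
    fun hA u ⟨y, hy, hyA⟩ hu => hA u hu y hy hyA⟩

end Named

theorem prefix_of_append_eq {α : Type*} {A B A' B' : List α} (h : A ++ B = A' ++ B')
    (hle : A.length ≤ A'.length) : A <+: A' :=
  List.prefix_of_prefix_length_le (h ▸ List.prefix_append A B) (List.prefix_append A' B') hle

/-- The open wires to the left of the inputs of `v` when `v` is plugged in. -/
def leftOf (f : Op n → ℕ) (v : Op n) : List (OutPort n) := (openWires f v.time).take (f v)

theorem Encodes.exists_openWires_leftOf (h : Encodes f g) (v : Op n) :
    ∃ B, (leftOf f v).length = f v ∧ openWires f v.time = leftOf f v ++ v.inputs.map g ++ B ∧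
      openWires f (v.time + 1) = leftOf f v ++ v.outputs ++ B := by
  obtain ⟨A, B, hA, hbefore, hafter⟩ := h.exists_openWires v
  have hleft : leftOf f v = A := by
    rw [leftOf, hbefore, ← hA, List.append_assoc, List.take_left]
  exact ⟨B, by rw [hleft, hA], by rw [hleft, hbefore], by rw [hleft, hafter]⟩

theorem Encodes.notMem_leftOf (h : Encodes f g) {v : Op n} {y : InPort n} (hy : y ∈ v.inputs) :
    g y ∉ leftOf f v := by
  obtain ⟨B, -, hB, -⟩ := h.exists_openWires_leftOf v
  exact (notMem_of_nodup_append (hB ▸ h.nodup_openWires v.time_lt.le) (List.mem_map_of_mem hy)).1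

theorem Encodes.leftOf_subset (h : Encodes f g) {v v' : Op n} (hnext : v'.time = v.time + 1)
    (hlt : f v < f v' + v'.inputs.length) : leftOf f v ⊆ leftOf f v' ++ v'.inputs.map g := by
  obtain ⟨B, hlen, -, hB⟩ := h.exists_openWires_leftOf v
  obtain ⟨B', hlen', hB', -⟩ := h.exists_openWires_leftOf v'
  rw [← hnext, hB', List.append_assoc (leftOf f v)] at hB
  refine (prefix_of_append_eq hB.symm ?_).subset
  rw [List.length_append, List.length_map]
  omega

theorem Encodes.mem_leftOf_of_add_length_le (h : Encodes f g) {v v' : Op n}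
    (hnext : v'.time = v.time + 1) (hle : f v' + v'.inputs.length ≤ f v) {y : InPort n}
    (hy : y ∈ v'.inputs) : g y ∈ leftOf f v := by
  obtain ⟨B, hlen, -, hB⟩ := h.exists_openWires_leftOf v
  obtain ⟨B', hlen', hB', -⟩ := h.exists_openWires_leftOf v'
  rw [← hnext, hB', List.append_assoc (leftOf f v)] at hB
  refine (prefix_of_append_eq hB ?_).subset
    (List.mem_append_right _ (List.mem_map_of_mem hy))
  rw [List.length_append, List.length_map]
  omega

theorem Encodes.mem_leftOf_of_le (h : Encodes f g) (hf : IsCode f) {v u : Op n} {y : InPort n}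
    (hyu : y ∈ u.inputs) (hyv : g y ∈ leftOf f v) {k : ℕ} (hvk : v.time ≤ k) :
    ∀ v' : Op n, v'.time = k → k < u.time → g y ∈ leftOf f v' := by
  induction k, hvk using Nat.le_induction with
  | base =>
    intro v' hv' _
    exact Op.time_injective hv' ▸ hyv
  | succ k hvk ih =>
    intro v' hv' hku
    obtain ⟨x, rfl⟩ := exists_time_eq (n := n) (k := k) (by have := u.time_lt; omega)
    rcases List.mem_append.1 (h.leftOf_subset hv' (hf.lt_of_next x v' hv')
      (ih x rfl (by omega))) with hleft | hinput
    · exact hleft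
    · obtain ⟨z, hz, hzy⟩ := List.mem_map.1 hinput
      have := h.le_time u.time_lt.le hz (hzy ▸ h.mem_openWires hyu)
      omega

theorem Encodes.exists_feeds_of_mem_leftOf (h : Encodes f g) {v u : Op n}
    (hnext : u.time = v.time + 1) (hlt : f v < f u + u.inputs.length) {y : InPort n}
    (hyu : y ∈ u.inputs) (hyv : g y ∈ leftOf f v) : ∃ z ∈ u.inputs, g z ∈ v.outputs := by
  obtain ⟨B, hlen, -, hB⟩ := h.exists_openWires_leftOf v
  obtain ⟨B', hlen', hB', -⟩ := h.exists_openWires_leftOf u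
  obtain ⟨x, l, hx⟩ : ∃ x l, v.outputs = x :: l := by cases v <;> simp [Op.outputs]
  rw [← hnext, hB', hx, List.append_assoc (leftOf f v)] at hB
  have hle : f u ≤ f v := by
    by_contra! hvu
    exact h.notMem_leftOf hyu ((prefix_of_append_eq
      ((List.append_assoc _ _ _).symm.trans hB).symm (by omega)).subset hyv)
  have hget := congrArg (·[f v]?) hB
  simp only [List.append_assoc] at hget
  rw [List.getElem?_append_right (hlen'.trans_le hle), hlen',
    List.getElem?_append_left (by rw [List.length_map]; omega),
    List.getElem?_append_right hlen.le, hlen, Nat.sub_self] at hget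
  obtain ⟨z, hz, hzx⟩ := List.mem_map.1 (List.mem_of_getElem? hget)
  exact ⟨z, hz, by simp [hzx, hx]⟩

theorem Encodes.notMem_leftOf_of_ready (h : Encodes f g) (hf : IsCode f) {v u : Op n}
    (hu : ∀ y ∈ u.inputs, g y ∈ openWires f v.time) {y : InPort n} (hy : y ∈ u.inputs) :
    g y ∉ leftOf f v := by
  intro hyv
  have hvu : v.time ≤ u.time := h.le_time v.time_lt.le hy (hu y hy)
  rcases hvu.eq_or_lt with heq | hlt
  · exact h.notMem_leftOf hy (Op.time_injective heq ▸ hyv)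
  · obtain ⟨v', hv'⟩ := exists_time_eq (n := n) (k := u.time - 1) (by have := u.time_lt; omega)
    have hnext : u.time = v'.time + 1 := by omega
    obtain ⟨z, hz, hzv'⟩ := h.exists_feeds_of_mem_leftOf hnext (hf.lt_of_next v' u hnext) hy
      (h.mem_leftOf_of_le hf hy hyv (k := v'.time) (by omega) v' rfl (by omega))
    have := h.time_lt v.time_lt.le hzv' (hu z hz)
    omega

theorem Encodes.frontier_eq {G : Named n} (h : Encodes f G.wire.symm) {k : ℕ} (hk : k ≤ 2 * n) :
    G.frontier k = openWires f k := by
  induction k, hk using time_induction with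
  | zero => rfl
  | succ v ih =>
    obtain ⟨A, B, -, hbefore, hafter⟩ := h.exists_openWires v
    rw [Named.frontier_succ, ih, Named.advance_eq (h.nodup_openWires v.time_lt.le) hbefore, hafter]

theorem Encodes.labelling_eq_canonicalOrder_iff {G : Named n} (h : Encodes f G.wire.symm) :
    G.labelling = canonicalOrder n ↔ IsCode f := by
  have leftmostReady_iff : ∀ v : Op n, G.leftmostReady (G.frontier v.time) = some v ↔
      ∀ u, G.Ready (openWires f v.time) u → ∀ y ∈ u.inputs, G.wire.symm y ∉ leftOf f v := by
    intro v
    obtain ⟨B, -, hB, -⟩ := h.exists_openWires_leftOf v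
    rw [h.frontier_eq v.time_lt.le,
      Named.leftmostReady_eq_some_iff (h.nodup_openWires v.time_lt.le) hB]
  simp only [Named.labelling_eq_canonicalOrder_iff, leftmostReady_iff]
  refine ⟨fun hleft => ⟨h.fits, fun u v hnext => ?_⟩,
    fun hf v u hu y hy => h.notMem_leftOf_of_ready hf hu hy⟩
  by_contra! hle
  have hinputs : ∀ y ∈ v.inputs, G.wire.symm y ∈ leftOf f u := fun y =>
    h.mem_leftOf_of_add_length_le hnext hle
  obtain ⟨y, hy⟩ := List.exists_mem_of_ne_nil _ v.inputs_ne_nil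
  exact hleft u v (fun z hz => List.mem_of_mem_take (hinputs z hz)) y hy (hinputs y hy)

end PCPrograph

/-! ## The code of a prograph -/

namespace PCPrograph

variable {n : ℕ}

section Regions

variable {α : Type*} {L R : OutPort n → α} {w : OutPort n ≃ InPort n} {name : FaceName n → α}
  {F : List (OutPort n)}

theorem Linked.exists_append {a b : α} (h : Linked L R a F b) (hnodup : (a :: F.map R).Nodup)
    {x y : OutPort n} (hx : x ∈ F) (hy : y ∈ F) (hxy : R x = L y) :
    ∃ A B, F = A ++ [x, y] ++ B := by
  obtain ⟨A, B, rfl⟩ := List.append_of_mem hy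
  obtain ⟨c, hA, hc, -⟩ := linked_append.1 h
  rcases List.eq_nil_or_concat A with rfl | ⟨A, z, rfl⟩
  · have hxa : R x = a := hxy.trans (hc.trans hA.symm)
    exact absurd (hxa ▸ List.mem_map_of_mem hx) (List.nodup_cons.1 hnodup).1
  · rw [List.concat_eq_append, linked_append] at hA
    obtain ⟨d, -, -, hz⟩ := hA
    have hxz : x = z := List.inj_on_of_nodup_map (List.nodup_cons.1 hnodup).2 hx (by simp)
      (hxy.trans (hc.trans hz.symm))
    exact ⟨A, B, by simp [hxz]⟩

theorem ClosedColoring.exists_append (C : ClosedColoring w name L R) {a b : α}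
    (h : Linked L R a F b) (hnodup : (a :: F.map R).Nodup) {v : Op n}
    (hv : ∀ y ∈ v.inputs, w.symm y ∈ F) : ∃ A B, F = A ++ v.inputs.map w.symm ++ B := by
  cases v with
  | cop c =>
    obtain ⟨A, B, rfl⟩ := List.append_of_mem (hv (.copIn c) (by simp [Op.inputs]))
    exact ⟨A, B, by simp [Op.inputs]⟩
  | prod p =>
    exact h.exists_append hnodup (hv (.prodLeft p) (by simp [Op.inputs]))
      (hv (.prodRight p) (by simp [Op.inputs])) (C.between p)

/-- The names of the regions opened by an operator. -/
def Op.opened : Op n → List (FaceName n)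
  | .cop c => [.inl c]
  | .prod _ => []

/-- The names of the regions that are open at some time in the first `k` steps. -/
def openedBefore (n k : ℕ) : List (FaceName n) :=
  [.inr false, .inr true] ++ ((canonicalOrder n).take k).flatMap Op.opened

theorem openedBefore_succ (v : Op n) :
    openedBefore n (v.time + 1) = openedBefore n v.time ++ v.opened := by
  rw [openedBefore, take_canonicalOrder_succ, List.flatMap_append, List.flatMap_singleton,
    ← List.append_assoc, openedBefore]

theorem nodup_openedBefore (n k : ℕ) : (openedBefore n k).Nodup := by
  refine List.nodup_append'.2 ⟨by simp, List.nodup_flatMap.2 ⟨?_, ?_⟩, ?_⟩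
  · rintro (c | p) _ <;> simp [Op.opened]
  · refine ((nodup_canonicalOrder n).sublist (List.take_sublist _ _)).imp ?_
    rintro (c | p) (d | q) h <;> simp_all [Op.opened, Function.onFun, eq_comm]
  · simp only [List.Disjoint, List.mem_flatMap]
    rintro x hx ⟨c | p, -, hxv⟩ <;> simp_all [Op.opened]

theorem RegionColoring.map_outputs_subperm (C : RegionColoring w name L R) (v : Op n) :
    (v.outputs.map R).Subperm ((v.inputs.map w.symm).map R ++ v.opened.map name) := by
  cases v with
  | cop c =>
    simp only [Op.inputs, Op.outputs, Op.opened, List.map_cons, List.map_nil, C.right_copLeft,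
      C.right_copRight]
    exact (List.Perm.swap _ _ _).subperm
  | prod p =>
    simp only [Op.inputs, Op.outputs, Op.opened, List.map_cons, List.map_nil, C.right_prodOut,
      List.append_nil]
    exact (List.sublist_cons_self _ _).subperm

/-- The open wires `F` after `k` steps separate distinct regions: the regions along `F`, from left
to right, are among those opened before, without repetition. -/
structure Separates (name : FaceName n → α) (L R : OutPort n → α) (k : ℕ)
    (F : List (OutPort n)) : Prop where
  linked : Linked L R (name (.inr false)) F (name (.inr true))
  subperm : (name (.inr false) :: F.map R).Subperm ((openedBefore n k).map name)

theorem RegionColoring.separates_source (C : RegionColoring w name L R) :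
    Separates name L R 0 [.source] :=
  ⟨⟨C.left_source, C.right_source⟩, by simp [openedBefore, C.right_source, List.Subperm.refl]⟩

theorem RegionColoring.separates_succ (C : RegionColoring w name L R) {v : Op n}
    {A B : List (OutPort n)} (h : Separates name L R v.time (A ++ v.inputs.map w.symm ++ B)) :
    Separates name L R (v.time + 1) (A ++ v.outputs ++ B) := by
  refine ⟨C.linked_append_outputs h.linked, ?_⟩
  have houtputs := Multiset.coe_le.2 (C.map_outputs_subperm v)
  have hopened := Multiset.coe_le.2 h.subperm
  rw [← Multiset.coe_le, openedBefore_succ]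
  simp only [List.map_append, ← Multiset.cons_coe, ← Multiset.coe_add,
    ← Multiset.singleton_add] at houtputs hopened ⊢
  set a : Multiset α := {name (.inr false)}
  calc a + (A.map R + v.outputs.map R + B.map R)
      = v.outputs.map R + (a + A.map R + B.map R) := by abel
    _ ≤ (v.inputs.map w.symm).map R + v.opened.map name + (a + A.map R + B.map R) := by gcongr
    _ = a + (A.map R + (v.inputs.map w.symm).map R + B.map R) + v.opened.map name := by abel
    _ ≤ (openedBefore n v.time).map name + v.opened.map name := by gcongr

theorem Separates.nodup (hname : Function.Injective name) {k : ℕ}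
    (h : Separates name L R k F) : (name (.inr false) :: F.map R).Nodup := by
  obtain ⟨l, hperm, hsub⟩ := h.subperm
  exact hperm.nodup_iff.1 (((nodup_openedBefore n k).map hname).sublist hsub)

end Regions

namespace Named

variable {G : Named n}

theorem exists_frontier_eq_of_separates {α : Type*} {L R : OutPort n → α} {name : FaceName n → α}
    (C : ClosedColoring G.wire name L R) (hname : Function.Injective name) {v : Op n}
    (hv : G.leftmostReady (G.frontier v.time) = some v)
    (h : Separates name L R v.time (G.frontier v.time)) :
    ∃ A B, G.frontier v.time = A ++ v.inputs.map G.wire.symm ++ B ∧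
      G.frontier (v.time + 1) = A ++ v.outputs ++ B := by
  have hready : G.Ready (G.frontier v.time) v := by
    simpa only [decide_eq_true_eq] using
      List.find?_some (p := fun u => decide (G.Ready (G.frontier v.time) u)) hv
  obtain ⟨A, B, hAB⟩ := C.exists_append h.linked (h.nodup hname) hready
  refine ⟨A, B, hAB, ?_⟩
  rw [frontier_succ, advance_eq (h.nodup hname).of_cons.of_map hAB]

theorem separates_frontier {α : Type*} {L R : OutPort n → α} {name : FaceName n → α}
    (C : ClosedColoring G.wire name L R) (hname : Function.Injective name)
    (hG : G.labelling = canonicalOrder n) {k : ℕ} (hk : k ≤ 2 * n) :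
    Separates name L R k (G.frontier k) := by
  induction k, hk using time_induction with
  | zero => exact C.separates_source
  | succ v ih =>
    obtain ⟨A, B, hbefore, hafter⟩ :=
      exists_frontier_eq_of_separates C hname (labelling_eq_canonicalOrder_iff.1 hG v) ih
    exact hafter ▸ C.separates_succ (hbefore ▸ ih)

theorem exists_frontier_eq (hG : G.labelling = canonicalOrder n) (v : Op n) :
    ∃ A B, G.frontier v.time = A ++ v.inputs.map G.wire.symm ++ B ∧
      G.frontier (v.time + 1) = A ++ v.outputs ++ B :=
  have C := closedColoring_faceOf G.wire
  have hname := G.nameFace_injective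
  exists_frontier_eq_of_separates C hname (labelling_eq_canonicalOrder_iff.1 hG v)
    (separates_frontier C hname hG v.time_lt.le)

theorem exists_encodes (hG : G.labelling = canonicalOrder n) : ∃ f, Encodes f G.wire.symm := by
  choose A B hbefore hafter using exists_frontier_eq hG
  refine ⟨fun v => (A v).length, fun v => ⟨A v, B v, ?_, rfl⟩⟩
  have frontier_eq : ∀ k ≤ 2 * n, G.frontier k = openWires (fun v => (A v).length) k := by
    intro k hk
    induction k, hk using time_induction with
    | zero => rfl
    | succ v ih =>
      rw [hafter, openWires_succ, ← ih, hbefore, plug_append rfl (List.length_map _)]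
  rw [← frontier_eq v.time v.time_lt.le, hbefore]

end Named

theorem card_canonical (n : ℕ) : Nat.card {G : Named n // G.labelling = canonicalOrder n} =
    Nat.card {f : Op n → ℕ // IsCode f} := by
  choose w hw using fun f : {f : Op n → ℕ // IsCode f} => f.2.exists_encodes
  refine (Nat.card_eq_of_bijective
    (fun f => ⟨(hw f).toNamed, (hw f).labelling_eq_canonicalOrder_iff.2 f.2⟩) ⟨?_, ?_⟩).symm
  · intro f f' h
    have hwire : w f = w f' := congrArg (fun G => G.1.wire) h
    exact Subtype.ext ((hw f).code_eq (hwire ▸ hw f'))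
  · rintro ⟨G, hG⟩
    obtain ⟨f, hf⟩ := Named.exists_encodes hG
    let code : {f : Op n → ℕ // IsCode f} := ⟨f, hf.labelling_eq_canonicalOrder_iff.1 hG⟩
    exact ⟨code, Subtype.ext (Named.ext ((hw code).wiring_eq hf))⟩

/-! ### Codes are pairs of ballot sequences -/

theorem monotone_of_le_next {p : Fin n → ℕ} (h : ∀ i j : Fin n, (j : ℕ) = i + 1 → p i ≤ p j) :
    Monotone p := by
  refine monotone_of_le_succ fun i hi => h _ _ ?_
  have hcov := Order.covBy_succ_of_not_isMax hi
  rw [Fin.covBy_iff, Nat.covBy_iff_add_one_eq] at hcov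
  exact hcov.symm

/-- The positions of the coproducts. -/
def lowerSeq (f : Op n → ℕ) (i : Fin n) : ℕ := f (.cop i)

/-- The positions of the products, listed from the last product to the first one and counted from
the right: `i - f (.prod i.rev)` wires are to the right of the inputs of `i.rev`. -/
def upperSeq (f : Op n → ℕ) (i : Fin n) : ℕ := i - f (.prod i.rev)

theorem width_cop (c : Fin n) : width n (Op.cop c).time = c + 1 := by
  simp only [width, Op.time]
  omega

theorem width_prod (p : Fin n) : width n (Op.prod p).time = p.rev + 2 := by
  simp only [width, Op.time, Fin.val_rev]
  omega

variable {f : Op n → ℕ}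

theorem IsCode.prod_le (hf : IsCode f) (i : Fin n) : f (.prod i.rev) ≤ i := by
  simpa [width_prod, Op.inputs] using hf.fits (.prod i.rev)

theorem IsCode.isBallot_lowerSeq (hf : IsCode f) : IsBallot (lowerSeq f) where
  mono := monotone_of_le_next fun i j hij => Nat.lt_succ_iff.1 (hf.lt_of_next (.cop i) (.cop j) hij)
  le i := by simpa [width_cop, Op.inputs, lowerSeq] using hf.fits (.cop i)

theorem IsCode.isBallot_upperSeq (hf : IsCode f) : IsBallot (upperSeq f) where
  mono := monotone_of_le_next fun i j hij => by
    have hle : f (.prod j.rev) < f (.prod i.rev) + 2 := hf.lt_of_next (.prod j.rev) (.prod i.rev)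
      (by simp only [Op.time, Fin.val_rev]; omega)
    have := hf.prod_le i
    simp only [upperSeq]
    omega
  le i := Nat.sub_le _ _

theorem IsCode.lowerSeq_add_upperSeq_le (hf : IsCode f) (i : Fin n) :
    lowerSeq f i + upperSeq f i ≤ n := by
  obtain _ | n := n
  · exact i.elim0
  · have hlt : f (.cop (.last n)) < f (.prod 0) + 2 :=
      hf.lt_of_next (.cop (.last n)) (.prod 0) (by simp [Op.time])
    have hprod := hf.prod_le (.last n)
    have hlower := hf.isBallot_lowerSeq.mono (Fin.le_last i)
    have hupper := hf.isBallot_upperSeq.mono (Fin.le_last i)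
    simp only [lowerSeq, upperSeq, Fin.rev_last, Fin.val_last] at *
    omega

theorem isCode_of_isBallot (hlower : IsBallot (lowerSeq f)) (hupper : IsBallot (upperSeq f))
    (hprod : ∀ i : Fin n, f (.prod i.rev) ≤ i) (hle : ∀ i, lowerSeq f i + upperSeq f i ≤ n) :
    IsCode f where
  fits
    | .cop c => by simpa [width_cop, Op.inputs, lowerSeq] using hlower.le c
    | .prod p => by simpa [width_prod, Op.inputs] using hprod p.rev
  lt_of_next u v hnext := by
    rcases u with c | p <;> rcases v with d | q <;> simp only [Op.time] at hnext
    · exact Nat.lt_succ_of_le (hlower.mono (Fin.le_def.2 (by omega)))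
    · obtain rfl : q = c.rev := Fin.ext (by rw [Fin.val_rev]; omega)
      have := hle c
      have := hprod c
      simp only [lowerSeq, upperSeq, Op.inputs, List.length_cons, List.length_nil] at *
      omega
    · omega
    · have hmono := hupper.mono (Fin.rev_le_rev.2 (Fin.le_def.2 (by omega : (p : ℕ) ≤ q)))
      have hprod_p := hprod p.rev
      simp only [upperSeq, Fin.rev_rev, Fin.val_rev, Op.inputs, List.length_cons,
        List.length_nil] at *
      omega

/-- The positions of the operators given by the two sequences `lowerSeq` and `upperSeq`. -/
def ofSeqs (p q : Fin n → ℕ) : Op n → ℕ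
  | .cop c => p c
  | .prod i => i.rev - q i.rev

theorem card_isCode (n : ℕ) : Nat.card {f : Op n → ℕ // IsCode f} =
    Nat.card {p : (Fin n → ℕ) × (Fin n → ℕ) //
      IsBallot p.1 ∧ IsBallot p.2 ∧ ∀ i, p.1 i + p.2 i ≤ n} := by
  refine Nat.card_eq_of_bijective (fun f => ⟨(lowerSeq f.1, upperSeq f.1),
    f.2.isBallot_lowerSeq, f.2.isBallot_upperSeq, f.2.lowerSeq_add_upperSeq_le⟩) ⟨?_, ?_⟩
  · rintro ⟨f, hf⟩ ⟨f', hf'⟩ h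
    simp only [Subtype.mk.injEq, Prod.mk.injEq, funext_iff] at h
    refine Subtype.ext (funext fun v => ?_)
    rcases v with c | p
    · exact h.1 c
    · have hupper := h.2 p.rev
      have := hf.prod_le p.rev
      have := hf'.prod_le p.rev
      simp only [upperSeq, Fin.rev_rev] at *
      omega
  · rintro ⟨⟨p, q⟩, hp, hq, hpq⟩
    have hlower : lowerSeq (ofSeqs p q) = p := rfl
    have hupper : upperSeq (ofSeqs p q) = q := funext fun i => by
      simpa [upperSeq, ofSeqs] using Nat.sub_sub_self (hq.le i)
    refine ⟨⟨ofSeqs p q, isCode_of_isBallot ?_ ?_ ?_ ?_⟩, Subtype.ext (Prod.ext hlower hupper)⟩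
    · rwa [hlower]
    · rwa [hupper]
    · simp [ofSeqs]
    · rwa [hlower, hupper]

theorem card_coproductsFirst_eq_card_treePairs (n : ℕ) :
    Nat.card {P : PCPrograph n // P.CoproductsFirst} =
      Nat.card {T : BinaryTree Unit × BinaryTree Unit //
        T.1.numNodes = n ∧ T.2.numNodes = n ∧ disabledSites T.1 + disabledSites T.2 ≤ n} := by
  rw [card_coproductsFirst, card_canonical, card_isCode, card_ballotPairs]

end PCPrograph

theorem mainTheorem4 (n : ℕ) :
    -- The prographs in question are counted by pairs of binary trees.
    Nat.card {P : PCPrograph n // P.CoproductsFirst} =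
      Nat.card {T : BinaryTree Unit × BinaryTree Unit //
        T.1.numNodes = n ∧ T.2.numNodes = n ∧ disabledSites T.1 + disabledSites T.2 ≤ n} ∧
    -- Their number as a sum over the Catalan triangle, and in closed form.
    (Nat.card {P : PCPrograph n // P.CoproductsFirst} : ℤ) =
      ∑ d ∈ Finset.range (n + 1) ×ˢ Finset.range (n + 1) with d.1 + d.2 ≤ n,
        catTriangle n d.1 * catTriangle n d.2 ∧
    ∑ d ∈ Finset.range (n + 1) ×ˢ Finset.range (n + 1) with d.1 + d.2 ≤ n,
        catTriangle n d.1 * catTriangle n d.2 =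
      binom (3 * n) n - 2 * binom (3 * n) ((n : ℤ) - 1) + binom (3 * n) ((n : ℤ) - 2) ∧
    -- The numbers in the sum are those of the Catalan triangle (here `n ≥ 1`).
    ∀ k < n, catTriangle n k =
      binom (n - 1 + k) k - binom (n - 1 + k) ((k : ℤ) - 1) := by
  have htrees := PCPrograph.card_coproductsFirst_eq_card_treePairs n
  exact ⟨htrees, htrees ▸ card_treePairs n, sum_catTriangle_mul n, fun _ hk =>
    catTriangle_eq_binom hk⟩
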